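/- Let $n \ge 8$ and $s$ be integers with $s^2 \equiv 1 \pmod n$ and $s \not\equiv \pm 1 \pmod n$, and let $G_{n,s} = C_n \rtimes_s C_2 = \langle x, y \mid x^2 = y^n = 1,\ yx = xy^s \rangle$. A sequence over a finite group $G$ is a finite unordered sequence of elements of $G$, repetition allowed. It is a product-one sequence if its terms can be ordered so that their product is $1$. It is product-one free if it has no non-empty product-one subsequence. Let $\mathsf d(G)$ be the maximal length of a product-one free sequence over $G$, and let $\mathsf E(G)$, $\mathsf s(G)$ and $\eta(G)$ be the smallest $\ell > 0$ such that every sequence over $G$ of length at least $\ell$ has a product-one subsequence of length $|G|$, of length $\exp(G)$, and of length in $[1, \exp(G)]$, respectively. If $n$ is odd, there are unique coprime integers $n_1, n_2 \ge 3$ with $n = n_1 n_2$, $s \equiv -1 \pmod{n_1}$ and $s \equiv 1 \pmod{n_2}$; in this case suppose additionally that $n_1 > 3$. Then $$\mathsf E(G_{n,s}) = 3n \qquad\text{and}\qquad \mathsf s(G_{n,s}) = \begin{cases} 2n & \text{if } n \text{ is even},\\ 3n & \text{if } n \text{ is odd}.\end{cases}$$ Moreover, the conjectures of Gao and of Zhuang–Gao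 hold for $G_{n,s}$, that is, $$\mathsf s(G_{n,s}) = \eta(G_{n,s}) + \exp(G_{n,s}) - 1 \qquad\text{and}\qquad \mathsf E(G_{n,s}) = \mathsf d(G_{n,s}) + |G_{n,s}|.$$ -/

import Mathlib

namespace ZeroSum

/-- The two generators in the presentation of `C_n ⋊_s C_2`. -/
inductive Gen : Type
  | x : Gen
  | y : Gen

/-- The relators `x ^ 2`, `y ^ n`, and `(y x) (x y ^ s)⁻¹`. -/
def rels (n : ℕ) (s : ℤ) : Set (FreeGroup Gen) :=
  {FreeGroup.of Gen.x ^ 2,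
   FreeGroup.of Gen.y ^ n,
   (FreeGroup.of Gen.y * FreeGroup.of Gen.x) *
     (FreeGroup.of Gen.x * FreeGroup.of Gen.y ^ s)⁻¹}

/-- The group `G_{n,s} = C_n ⋊_s C_2 = ⟨x, y ∣ x² = yⁿ = 1, y x = x yˢ⟩`. -/
abbrev Gns (n : ℕ) (s : ℤ) : Type := PresentedGroup (rels n s)

/-- A (finite, unordered) sequence over `G` is a `Multiset G`; its length is `Multiset.card` and
subsequences are given by `≤`. The set of products `π(S)` consists of the products of the terms
of `S`, taken in all possible orders. -/
def products {G : Type*} [Group G] (S : Multiset G) : Set G :=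
  {g | ∃ l : List G, (l : Multiset G) = S ∧ l.prod = g}

/-- `S` is a product-one sequence. -/
def IsProductOne {G : Type*} [Group G] (S : Multiset G) : Prop :=
  (1 : G) ∈ products S

/-- `S` has a product-one subsequence of length `k`. -/
def HasProductOneSub {G : Type*} [Group G] (k : ℕ) (S : Multiset G) : Prop :=
  ∃ T : Multiset G, T ≤ S ∧ Multiset.card T = k ∧ IsProductOne T

/-- `S` is product-one free: it has no non-empty product-one subsequence. -/
def IsProductOneFree {G : Type*} [Group G] (S : Multiset G) : Prop :=
  ∀ T : Multiset G, T ≤ S → 1 ≤ Multiset.card T → ¬ IsProductOne T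

/-- `S` has a short product-one subsequence, i.e. one of length between `1` and `exp G`. -/
def HasShortProductOneSub {G : Type*} [Group G] (S : Multiset G) : Prop :=
  ∃ T : Multiset G, T ≤ S ∧ 1 ≤ Multiset.card T ∧ Multiset.card T ≤ Monoid.exponent G ∧
    IsProductOne T

/-- The small Davenport constant `d(G)`: the maximal length of a product-one free sequence. -/
noncomputable def smallDavenport (G : Type*) [Group G] : ℕ :=
  sSup {k | ∃ S : Multiset G, Multiset.card S = k ∧ IsProductOneFree S}

/-- The Gao constant `E(G)`: the smallest `ℓ > 0` such that every sequence of length at least `ℓ`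
has a product-one subsequence of length `|G|`. -/
noncomputable def gaoConstant (G : Type*) [Group G] : ℕ :=
  sInf {l | 0 < l ∧ ∀ S : Multiset G, l ≤ Multiset.card S → HasProductOneSub (Nat.card G) S}

/-- The constant `η(G)`: the smallest `ℓ > 0` such that every sequence of length at least `ℓ`
has a short product-one subsequence. -/
noncomputable def etaConstant (G : Type*) [Group G] : ℕ :=
  sInf {l | 0 < l ∧ ∀ S : Multiset G, l ≤ Multiset.card S → HasShortProductOneSub S}

/-- The Erdős–Ginzburg–Ziv constant `s(G)`: the smallest `ℓ > 0` such that every sequence of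
length at least `ℓ` has a product-one subsequence of length `exp G`. -/
noncomputable def egzConstant (G : Type*) [Group G] : ℕ :=
  sInf {l | 0 < l ∧ ∀ S : Multiset G, l ≤ Multiset.card S →
    HasProductOneSub (Monoid.exponent G) S}

/-- For odd `n`, the factorization `n = n₁ n₂` attached to `s`: the factors are coprime and at
least `3`, with `s ≡ -1 (mod n₁)` and `s ≡ 1 (mod n₂)`. -/
def IsFactorization (n : ℕ) (s : ℤ) (n₁ n₂ : ℕ) : Prop :=
  n = n₁ * n₂ ∧ Nat.Coprime n₁ n₂ ∧ 3 ≤ n₁ ∧ 3 ≤ n₂ ∧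
    s ≡ -1 [ZMOD (n₁ : ℤ)] ∧ s ≡ 1 [ZMOD (n₂ : ℤ)]

end ZeroSum

/-!
The sequence consisting of `x` and `n - 1` copies of `y` is product-one free, and padding it with
copies of `1` shows that the asserted values are lower bounds.

For even `n`, two terms in the same coset of `⟨y²⟩` multiply to an element of `⟨y²⟩`. Hence the
terms can be paired off so that the Erdős–Ginzburg–Ziv theorem for the cyclic group `⟨y²⟩` of order
`n / 2` applies to the products of the pairs. This is one pair short of what is needed only in
extremal cases, which the non-commutativity of the group rules out.

For odd `n`, `⟨y⟩` is `C_{n₁} × C_{n₂}`, where `x` inverts the first factor and centralises the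
second. Terms are collected until their sum in `C_{n₂}` vanishes. Moving a term of `⟨y⟩` past one
outside of `⟨y⟩` changes its sign in `C_{n₁}`, so that reordering changes the product by a subset
sum. If these subset sums stop growing before they fill `C_{n₁}`, then few terms of `⟨y⟩` have their
`C_{n₁}`-component outside of the stabiliser of the set of subset sums, and for the remaining terms
pairing works as in the even case, with a smaller cyclic group.
-/

namespace ZeroSum

open scoped Pointwise

section Multisets

variable {α β : Type*}

theorem exists_le_map_iff {f : α → β} {S : Multiset α} {P : Multiset β → Prop} :
    (∃ T ≤ S.map f, P T) ↔ ∃ T ≤ S, P (T.map f) := by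
  constructor
  · rintro ⟨T, hT, hP⟩
    have hmem := Multiset.mem_powersetCard.2 ⟨hT, rfl⟩
    rw [Multiset.powersetCard_map, Multiset.mem_map] at hmem
    obtain ⟨S', hS', rfl⟩ := hmem
    exact ⟨S', (Multiset.mem_powersetCard.1 hS').1, hP⟩
  · rintro ⟨T, hT, hP⟩
    exact ⟨T.map f, Multiset.map_le_map hT, hP⟩

theorem exists_le_card_eq {S : Multiset α} {k : ℕ} (h : k ≤ Multiset.card S) :
    ∃ T ≤ S, Multiset.card T = k := by
  have hpos : 0 < Multiset.card (S.powersetCard k) := by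
    rw [Multiset.card_powersetCard]
    exact Nat.choose_pos h
  obtain ⟨T, hT⟩ := Multiset.card_pos_iff_exists_mem.1 hpos
  exact ⟨T, Multiset.mem_powersetCard.1 hT⟩

theorem le_cons_iff {a : α} {S T : Multiset α} :
    T ≤ a ::ₘ S ↔ T ≤ S ∨ ∃ T' ≤ S, a ::ₘ T' = T := by
  simp only [← Multiset.mem_powerset, Multiset.powerset_cons, Multiset.mem_add, Multiset.mem_map]

theorem exists_eq_add_of_le_add {S T U : Multiset α} (h : S ≤ T + U) :
    ∃ S₁ ≤ T, ∃ S₂ ≤ U, S = S₁ + S₂ := by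
  classical
  exact ⟨S ∩ T, Multiset.inter_le_right, S - T, tsub_le_iff_left.2 h,
    by rw [add_comm, Multiset.sub_add_inter]⟩

theorem add_le_of_le_tsub [DecidableEq α] {S T U : Multiset α} (hT : T ≤ S) (hU : U ≤ S - T) :
    T + U ≤ S := by
  rw [← add_tsub_cancel_of_le hT]
  gcongr

theorem sum_count_le_card [DecidableEq α] (s : Finset α) (S : Multiset α) :
    ∑ a ∈ s, S.count a ≤ Multiset.card S := by
  rw [← Multiset.sum_count_eq_card (s := s ∪ S.toFinset) (by simp +contextual)]
  exact Finset.sum_le_sum_of_subset Finset.subset_union_left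

/-- The multiset of all components of a multiset of pairs. -/
def flatten (Q : Multiset (α × α)) : Multiset α := Q.map Prod.fst + Q.map Prod.snd

@[simp] theorem flatten_zero : flatten (0 : Multiset (α × α)) = 0 := rfl

theorem flatten_cons (q : α × α) (Q : Multiset (α × α)) :
    flatten (q ::ₘ Q) = q.1 ::ₘ q.2 ::ₘ flatten Q := by
  simp only [flatten, Multiset.map_cons, Multiset.cons_add, Multiset.add_cons]
  exact Multiset.cons_swap _ _ _

@[simp] theorem card_flatten (Q : Multiset (α × α)) :
    Multiset.card (flatten Q) = 2 * Multiset.card Q := by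
  simp [flatten, two_mul]

theorem flatten_add (Q R : Multiset (α × α)) : flatten (Q + R) = flatten Q + flatten R := by
  simp only [flatten, Multiset.map_add]
  exact add_add_add_comm _ _ _ _

theorem fst_mem_flatten {q : α × α} {Q : Multiset (α × α)} (hq : q ∈ Q) : q.1 ∈ flatten Q :=
  Multiset.mem_add.2 (.inl (Multiset.mem_map_of_mem _ hq))

theorem snd_mem_flatten {q : α × α} {Q : Multiset (α × α)} (hq : q ∈ Q) : q.2 ∈ flatten Q :=
  Multiset.mem_add.2 (.inr (Multiset.mem_map_of_mem _ hq))

theorem flatten_mono {Q R : Multiset (α × α)} (h : Q ≤ R) : flatten Q ≤ flatten R :=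
  add_le_add (Multiset.map_le_map h) (Multiset.map_le_map h)

theorem exists_pairing (κ : α → β) (S : Multiset α) :
    ∃ (Q : Multiset (α × α)) (L : Multiset α), flatten Q + L = S ∧
      (∀ q ∈ Q, κ q.1 = κ q.2) ∧ (L.map κ).Nodup := by
  induction S using Multiset.induction with
  | empty => exact ⟨0, 0, by simp⟩
  | cons a S ih =>
    obtain ⟨Q, L, rfl, hQ, hL⟩ := ih
    by_cases h : κ a ∈ L.map κ
    · obtain ⟨l, hl, hla⟩ := Multiset.mem_map.1 h
      obtain ⟨L', rfl⟩ := Multiset.exists_cons_of_mem hl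
      rw [Multiset.map_cons, Multiset.nodup_cons] at hL
      refine ⟨(a, l) ::ₘ Q, L', by simp [flatten_cons], ?_, hL.2⟩
      simpa [hla] using hQ
    · exact ⟨Q, a ::ₘ L, by simp, hQ, by simpa using ⟨by simpa using h, hL⟩⟩

theorem exists_pairing_card [Finite β] (κ : α → β) (S : Multiset α) :
    ∃ Q : Multiset (α × α), flatten Q ≤ S ∧ (∀ q ∈ Q, κ q.1 = κ q.2) ∧
      Multiset.card S ≤ 2 * Multiset.card Q + Nat.card β := by
  have := Fintype.ofFinite β
  classical
  obtain ⟨Q, L, rfl, hQ, hL⟩ := exists_pairing κ S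
  refine ⟨Q, Multiset.le_add_right _ _, hQ, ?_⟩
  have hcard : Multiset.card (L.map κ) ≤ Fintype.card β :=
    Multiset.toFinset_card_of_nodup hL ▸ Finset.card_le_univ _
  simpa [Nat.card_eq_fintype_card] using hcard

theorem exists_flatten_le {S : Multiset α} {k : ℕ} (h : 2 * k ≤ Multiset.card S) :
    ∃ Q : Multiset (α × α), flatten Q ≤ S ∧ Multiset.card Q = k := by
  obtain ⟨Q, hQS, -, hQ⟩ := exists_pairing_card (fun _ => ()) S
  rw [Nat.card_unique] at hQ
  obtain ⟨P, hPQ, hP⟩ := exists_le_card_eq (show k ≤ Multiset.card Q by omega)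
  exact ⟨P, (flatten_mono hPQ).trans hQS, hP⟩

theorem exists_pairing_ne [DecidableEq α] {k : ℕ} {S : Multiset α}
    (hS : Multiset.card S = 2 * k) (hcount : ∀ a, S.count a ≤ k) :
    ∃ Q : Multiset (α × α), flatten Q = S ∧ ∀ q ∈ Q, q.1 ≠ q.2 := by
  induction k generalizing S with
  | zero => exact ⟨0, by simpa using (Multiset.card_eq_zero.1 hS).symm, by simp⟩
  | succ k ih =>
    -- Pairing off a term of maximal multiplicity keeps the bound on the multiplicities.
    obtain ⟨a, ha, hmax⟩ := S.toFinset.exists_max_image (S.count ·) <| by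
      rw [Multiset.toFinset_nonempty, ne_eq, ← Multiset.card_eq_zero]
      omega
    obtain ⟨b, hb, hab⟩ : ∃ b ∈ S, a ≠ b := by
      by_contra! h
      have := hcount a
      rw [Multiset.count_eq_card.2 h] at this
      omega
    obtain ⟨S, rfl⟩ := Multiset.exists_cons_of_mem (Multiset.mem_toFinset.1 ha)
    obtain ⟨S, rfl⟩ := Multiset.exists_cons_of_mem ((Multiset.mem_cons.1 hb).resolve_left hab.symm)
    obtain ⟨Q, rfl, hQ⟩ := ih (S := S) (by simpa [mul_add] using hS) fun c => by
      by_contra! hc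
      have hca : c ≠ a := by grind [Multiset.count_cons]
      have hcb : c ≠ b := by grind [Multiset.count_cons, hcount b]
      have hle := sum_count_le_card {a, b, c} (a ::ₘ b ::ₘ S)
      have hca_le := hmax c (by simp [Multiset.count_pos.1 (pos_of_gt hc)])
      rw [Finset.sum_insert (by simp [hab, hca.symm]), Finset.sum_pair hcb.symm] at hle
      grind [Multiset.count_cons]
    exact ⟨(a, b) ::ₘ Q, flatten_cons _ _, by simpa [hab] using hQ⟩

/-- `S` consists of the pairs in `Q`, each inside a class of `κ`, and of one further
representative `r c` for every class `c`. -/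
structure IsCompletePairing [Fintype β] (κ : α → β) (S : Multiset α) (Q : Multiset (α × α))
    (r : β → α) : Prop where
  flatten_add : flatten Q + Finset.univ.val.map r = S
  map_fst_eq : ∀ q ∈ Q, κ q.1 = κ q.2
  map_rep : ∀ c, κ (r c) = c

theorem exists_isCompletePairing_or [Fintype β] (κ : α → β) (S : Multiset α) :
    (∃ Q r, IsCompletePairing κ S Q r) ∨
      ∃ Q : Multiset (α × α), flatten Q ≤ S ∧ (∀ q ∈ Q, κ q.1 = κ q.2) ∧
        Multiset.card S < 2 * Multiset.card Q + Fintype.card β := by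
  obtain ⟨Q, L, rfl, hQ, hL⟩ := exists_pairing κ S
  have hle : L.map κ ≤ Finset.univ.val := (Multiset.le_iff_subset hL).2 fun c _ => by simp
  obtain hlt | heq := (Multiset.card_le_card hle).lt_or_eq
  · exact .inr ⟨Q, Multiset.le_add_right _ _, hQ, by simpa using hlt⟩
  have huniv : L.map κ = Finset.univ.val := Multiset.eq_of_le_of_card_le hle heq.ge
  have hmem (c : β) : ∃ t ∈ L, κ t = c := by
    rw [← Multiset.mem_map, huniv]
    exact Finset.mem_univ c
  choose r hrL hr using hmem
  have hrL : Finset.univ.val.map r ≤ L :=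
    (Multiset.le_iff_subset
      (Finset.univ.nodup.map (Function.LeftInverse.injective hr))).2 fun t ht => by
        obtain ⟨c, -, rfl⟩ := Multiset.mem_map.1 ht
        exact hrL c
  refine .inl ⟨Q, r, ?_, hQ, hr⟩
  rw [Multiset.eq_of_le_of_card_le hrL (by simpa using heq.le)]

theorem IsCompletePairing.exists_update [Fintype β] [DecidableEq β] {κ : α → β} {S : Multiset α}
    {Q : Multiset (α × α)} {r : β → α} (h : IsCompletePairing κ S Q r) {g : α}
    (hg : g ∈ flatten Q) : ∃ Q', IsCompletePairing κ S Q' (Function.update r (κ g) g) := by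
  obtain ⟨q, hq, g', hg', hqg⟩ :
      ∃ q ∈ Q, ∃ g', κ g' = κ g ∧ ({q.1, q.2} : Multiset α) = {g, g'} := by
    rcases Multiset.mem_add.1 hg with hg | hg
    · obtain ⟨q, hq, rfl⟩ := Multiset.mem_map.1 hg
      exact ⟨q, hq, q.2, (h.map_fst_eq q hq).symm, rfl⟩
    · obtain ⟨q, hq, rfl⟩ := Multiset.mem_map.1 hg
      exact ⟨q, hq, q.1, h.map_fst_eq q hq, Multiset.cons_swap _ _ _⟩
  obtain ⟨R, rfl⟩ := Multiset.exists_cons_of_mem hq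
  have hR := (Multiset.forall_mem_cons.1 h.map_fst_eq).2
  refine ⟨(r (κ g), g') ::ₘ R, ?_, Multiset.forall_mem_cons.2 ⟨?_, hR⟩, fun c => ?_⟩
  · have hrest : (Finset.univ.erase (κ g)).val.map (Function.update r (κ g) g) =
        (Finset.univ.erase (κ g)).val.map r :=
      Multiset.map_congr rfl fun c hc => Function.update_of_ne (Finset.ne_of_mem_erase hc) _ _
    rw [← h.flatten_add, ← Finset.insert_erase (Finset.mem_univ (κ g)),
      Finset.insert_val_of_notMem (Finset.notMem_erase _ _), Multiset.map_cons, Multiset.map_cons,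
      hrest, Function.update_self, flatten_cons, flatten_cons]
    simp only [Multiset.insert_eq_cons, ← Multiset.singleton_add] at hqg ⊢
    rw [← add_assoc {q.1}, hqg]
    abel
  · rw [h.map_rep, hg']
  · obtain rfl | hc := eq_or_ne c (κ g)
    · rw [Function.update_self]
    · rw [Function.update_of_ne hc, h.map_rep]

end Multisets

section InverseEGZ

/-- Some `k` terms of `S` have sum congruent to `t` modulo `M`; in the notation of zero-sum theory,
the class of `t` lies in `Σₖ(S)`. -/
def HasSubsum (M k : ℕ) (S : Multiset ℤ) (t : ℤ) : Prop :=
  ∃ T ≤ S, Multiset.card T = k ∧ T.sum ≡ t [ZMOD M]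

theorem hasSubsum_zero_of_two_mul_le {M : ℕ} {S : Multiset ℤ}
    (hS : 2 * M ≤ Multiset.card S + 1) : HasSubsum M M S 0 := by
  obtain ⟨T, hT, hTc, hTs⟩ := Int.erdos_ginzburg_ziv_multiset (n := M) S (by omega)
  exact ⟨T, hT, hTc, Int.modEq_zero_iff_dvd.2 hTs⟩

theorem hasSubsum_zero_of_dvd {M k : ℕ} {S : Multiset ℤ} (hk : M ∣ k)
    (hS : k + M ≤ Multiset.card S + 1) : HasSubsum M k S 0 := by
  obtain ⟨j, rfl⟩ := hk
  induction j with
  | zero => exact ⟨0, Multiset.zero_le _, by simp⟩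
  | succ j ih =>
    obtain ⟨T, hT, hTc, hTs⟩ := ih (by grind)
    obtain ⟨U, hU, hUc, hUs⟩ := hasSubsum_zero_of_two_mul_le (M := M) (S := S - T) (by
      rw [Multiset.card_sub hT, hTc]; grind)
    exact ⟨T + U, add_le_of_le_tsub hT hU, by rw [Multiset.card_add, hTc, hUc]; ring,
      by simpa using hTs.add hUs⟩

theorem hasSubsum_of_not_hasSubsum_succ {k : ℕ} {V : Multiset ℤ} (hV : Multiset.card V = 2 * k)
    (h0 : ¬ HasSubsum (k + 1) (k + 1) V 0) (u : ℤ) : HasSubsum (k + 1) k V u := by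
  obtain ⟨U, hU, hUc, hUs⟩ := hasSubsum_zero_of_two_mul_le (M := k + 1) (S := -u ::ₘ V) (by
    rw [Multiset.card_cons]; omega)
  rcases le_cons_iff.1 hU with hU | ⟨U', hU', rfl⟩
  · exact absurd ⟨U, hU, hUc, hUs⟩ h0
  · rw [Multiset.sum_cons] at hUs
    exact ⟨U', hU', by simpa using hUc, by simpa using hUs.add_left u⟩

/-- `V` consists of the values `(∑ b) / p` over disjoint blocks `b` of `p` terms of `B`, recorded
through what this provides: subsums of `V` lift to subsums of `B`. -/
def LiftsTo (p : ℕ) (V B : Multiset ℤ) : Prop :=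
  ∀ U ≤ V, ∃ T ≤ B, Multiset.card T = p * Multiset.card U ∧ T.sum = p * U.sum

theorem LiftsTo.cons {p : ℕ} {V B b : Multiset ℤ} {v : ℤ} (h : LiftsTo p V B)
    (hb : Multiset.card b = p) (hv : b.sum = p * v) : LiftsTo p (v ::ₘ V) (b + B) := by
  intro U hU
  rcases le_cons_iff.1 hU with hU | ⟨U', hU', rfl⟩
  · obtain ⟨T, hT, hTU⟩ := h U hU
    exact ⟨T, hT.trans (Multiset.le_add_left _ _), hTU⟩
  · obtain ⟨T, hT, hTc, hTs⟩ := h U' hU'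
    exact ⟨b + T, by gcongr, by rw [Multiset.card_add, hb, hTc, Multiset.card_cons]; ring,
      by rw [Multiset.sum_add, hv, hTs, Multiset.sum_cons]; ring⟩

theorem LiftsTo.hasSubsum {p M k : ℕ} {V B : Multiset ℤ} {u : ℤ} (h : LiftsTo p V B)
    (hu : HasSubsum M k V u) : HasSubsum (p * M) (p * k) B (p * u) := by
  obtain ⟨U, hU, rfl, hUs⟩ := hu
  obtain ⟨T, hT, hTc, hTs⟩ := h U hU
  exact ⟨T, hT, hTc, by rw [hTs, Nat.cast_mul]; exact hUs.mul_left'⟩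

theorem LiftsTo.hasSubsum_add {p k : ℕ} {V B R : Multiset ℤ} (h : LiftsTo p V B)
    (hV : ∀ u, HasSubsum (k + 1) k V u) {t : ℤ} (hR : HasSubsum p p R t) :
    HasSubsum (p * (k + 1)) (p * (k + 1)) (B + R) t := by
  obtain ⟨T, hT, hTc, hTs⟩ := hR
  obtain ⟨u, hu⟩ := hTs.dvd
  obtain ⟨T', hT', hTc', hTs'⟩ := h.hasSubsum (hV u)
  refine ⟨T' + T, by gcongr, by rw [Multiset.card_add, hTc, hTc']; ring, ?_⟩
  rw [Multiset.sum_add, show t = p * u + T.sum by rw [← hu]; ring]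
  exact hTs'.add_right _

theorem exists_liftsTo {p j : ℕ} {S : Multiset ℤ} (h : (j + 1) * p ≤ Multiset.card S + 1) :
    ∃ V B, LiftsTo p V B ∧ B ≤ S ∧ Multiset.card V = j ∧ Multiset.card B = j * p := by
  induction j with
  | zero => exact ⟨0, 0, fun U hU => ⟨0, le_rfl, by simp [Multiset.le_zero.1 hU]⟩, by simp⟩
  | succ j ih =>
    obtain ⟨V, B, hVB, hB, hVc, hBc⟩ := ih (by grind)
    obtain ⟨b, hb, hbc, hbs⟩ := hasSubsum_zero_of_two_mul_le (M := p) (S := S - B) (by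
      rw [Multiset.card_sub hB, hBc]; grind)
    obtain ⟨v, hv⟩ := Int.modEq_zero_iff_dvd.1 hbs
    exact ⟨v ::ₘ V, b + B, hVB.cons hbc hv, by rw [add_comm]; exact add_le_of_le_tsub hB hb,
      by rw [Multiset.card_cons, hVc], by rw [Multiset.card_add, hbc, hBc]; ring⟩

theorem exists_choice_sums_card_le {p : ℕ} (hp : p.Prime) {Q : Multiset (ZMod p × ZMod p)}
    (hQ : ∀ q ∈ Q, q.1 ≠ q.2) :
    ∃ X : Finset (ZMod p), min p (Multiset.card Q + 1) ≤ X.card ∧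
      ∀ x ∈ X, ∃ T ≤ flatten Q, Multiset.card T = Multiset.card Q ∧ T.sum = x := by
  induction Q using Multiset.induction with
  | empty => exact ⟨{0}, by simp, by simp⟩
  | cons q Q ih =>
    obtain ⟨X, hXc, hX⟩ := ih fun q hq => hQ q (Multiset.mem_cons_of_mem hq)
    have hpos : X.Nonempty := Finset.card_pos.1 (by have := hp.pos; omega)
    refine ⟨X + {q.1, q.2}, ?_, fun x hx => ?_⟩
    · have := ZMod.cauchy_davenport hp hpos (t := {q.1, q.2}) (by simp)
      rw [Finset.card_pair (hQ q (Multiset.mem_cons_self _ _))] at this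
      rw [Multiset.card_cons]
      omega
    · obtain ⟨y, hy, c, hc, rfl⟩ := Finset.mem_add.1 hx
      obtain ⟨T, hT, hTc, rfl⟩ := hX y hy
      have hcq : c ::ₘ T ≤ flatten (q ::ₘ Q) := by
        rw [flatten_cons]
        rcases Finset.mem_insert.1 hc with rfl | hc
        · exact Multiset.cons_le_cons _ (hT.trans (Multiset.le_cons_self _ _))
        · rw [Finset.mem_singleton.1 hc]
          exact (Multiset.cons_le_cons _ hT).trans (Multiset.le_cons_self _ _)
      exact ⟨c ::ₘ T, hcq, by simp [hTc], by simp [add_comm]⟩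

theorem exists_sum_eq_of_prime {p : ℕ} (hp : p.Prime) {S : Multiset (ZMod p)}
    (hS : Multiset.card S + 2 = 2 * p) (h0 : ∀ T ≤ S, Multiset.card T = p → T.sum ≠ 0)
    {t : ZMod p} (ht : t ≠ 0) : ∃ T ≤ S, Multiset.card T = p ∧ T.sum = t := by
  have := Fact.mk hp
  have hp2 := hp.two_le
  have hcount (a : ZMod p) : S.count a ≤ p - 1 := by
    by_contra! ha
    exact h0 (Multiset.replicate p a) (Multiset.le_count_iff_replicate_le.1 (by omega)) (by simp)
      (by simp)
  obtain ⟨Q, rfl, hQ⟩ := exists_pairing_ne (k := p - 1) (by omega) hcount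
  rw [card_flatten] at hS
  obtain ⟨q, hq⟩ := Multiset.card_pos_iff_exists_mem.1 (show 0 < Multiset.card Q by omega)
  obtain ⟨R, rfl⟩ := Multiset.exists_cons_of_mem hq
  rw [Multiset.card_cons] at hS
  obtain ⟨X, hXc, hX⟩ := exists_choice_sums_card_le hp
    fun r hr => hQ r (Multiset.mem_cons_of_mem hr)
  have hsum : ∀ x ∈ X, ∃ T ≤ flatten (q ::ₘ R), Multiset.card T = p ∧ T.sum = q.1 + q.2 + x := by
    intro x hx
    obtain ⟨T, hT, hTc, rfl⟩ := hX x hx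
    refine ⟨q.1 ::ₘ q.2 ::ₘ T, ?_, ?_, by simp [add_assoc]⟩
    · rw [flatten_cons]
      exact Multiset.cons_le_cons _ (Multiset.cons_le_cons _ hT)
    · rw [Multiset.card_cons, Multiset.card_cons]
      omega
  by_contra! hne
  -- The sums of `p` terms number at least `p - 1`, so they cannot miss both `0` and `t`.
  have hsub : X.image (q.1 + q.2 + ·) ⊆ {0, t}ᶜ := by
    refine Finset.image_subset_iff.2 fun x hx => ?_
    obtain ⟨T, hT, hTc, hTs⟩ := hsum x hx
    simpa [← hTs] using ⟨h0 T hT hTc, hne T hT hTc⟩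
  have hle := Finset.card_le_card hsub
  rw [Finset.card_image_of_injective _ (add_right_injective _), Finset.card_compl, ZMod.card,
    Finset.card_pair ht.symm] at hle
  omega

theorem hasSubsum_map_iff {A β : Type*} [AddCommGroup A] {g : A} {φ : β → A} {ψ : β → ℤ}
    {S : Multiset β} (hψ : ∀ b ∈ S, ψ b • g = φ b) {k : ℕ} {t : ℤ} :
    HasSubsum (addOrderOf g) k (S.map ψ) t ↔
      ∃ T ≤ S, Multiset.card T = k ∧ (T.map φ).sum = t • g := by
  have hsum {T} (hT : T ≤ S) : (T.map φ).sum = (T.map ψ).sum • g := by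
    rw [Multiset.sum_smul, Multiset.map_map]
    exact congrArg _ (Multiset.map_congr rfl fun b hb => (hψ b (Multiset.mem_of_le hT hb)).symm)
  rw [HasSubsum, exists_le_map_iff]
  refine exists_congr fun T => and_congr_right fun hT => ?_
  rw [Multiset.card_map, hsum hT, zsmul_eq_zsmul_iff_modEq]

theorem hasSubsum_of_prime {p : ℕ} (hp : p.Prime) {S : Multiset ℤ}
    (hS : Multiset.card S + 2 = 2 * p) (h0 : ¬ HasSubsum p p S 0) {t : ℤ} (ht : ¬ (p : ℤ) ∣ t) :
    HasSubsum p p S t := by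
  have hiff (u : ℤ) : HasSubsum p p S u ↔
      ∃ T ≤ S.map (Int.cast : ℤ → ZMod p), Multiset.card T = p ∧ T.sum = u := by
    have key := hasSubsum_map_iff (g := (1 : ZMod p)) (φ := Int.cast) (ψ := id) (S := S)
      (by simp) (k := p) (t := u)
    rw [ZMod.addOrderOf_one, Multiset.map_id, zsmul_one] at key
    rw [key, exists_le_map_iff]
    simp only [Multiset.card_map]
  rw [hiff] at h0 ⊢
  push Not at h0
  exact exists_sum_eq_of_prime hp (by simpa using hS) (by simpa using h0)
    (by rwa [ne_eq, ZMod.intCast_zmod_eq_zero_iff_dvd])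

/-- An inverse theorem for the Erdős–Ginzburg–Ziv theorem, one term below its threshold. -/
theorem hasSubsum_of_not_dvd {M : ℕ} {S : Multiset ℤ} (hS : Multiset.card S + 2 = 2 * M)
    (h0 : ¬ HasSubsum M M S 0) {t : ℤ} (ht : ¬ (M : ℤ) ∣ t) : HasSubsum M M S t := by
  classical
  induction M using induction_on_primes generalizing S t with
  | zero => omega
  | one => exact absurd (by simp) ht
  | prime_mul p k hp ih =>
    have hp0 := hp.pos
    obtain ⟨k, rfl⟩ : ∃ j, k = j + 1 := Nat.exists_eq_succ_of_ne_zero (by rintro rfl; omega)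
    obtain ⟨V, B, hVB, hB, hVc, hBc⟩ := exists_liftsTo (p := p) (j := 2 * k) (S := S) (by grind)
    obtain ⟨R, rfl⟩ := Multiset.le_iff_exists_add.1 hB
    have hRc : Multiset.card R + 2 = 2 * p := by rw [Multiset.card_add] at hS; grind
    have hlift {u : ℤ} (hu : HasSubsum (k + 1) (k + 1) V u) :
        HasSubsum (p * (k + 1)) (p * (k + 1)) (B + R) (p * u) := by
      obtain ⟨T, hT, hTcs⟩ := hVB.hasSubsum hu
      exact ⟨T, hT.trans (Multiset.le_add_right _ _), hTcs⟩
    have hV0 : ¬ HasSubsum (k + 1) (k + 1) V 0 := fun h => h0 (by simpa using hlift h)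
    have hV := hasSubsum_of_not_hasSubsum_succ hVc hV0
    by_cases hpt : (p : ℤ) ∣ t
    · obtain ⟨t, rfl⟩ := hpt
      exact hlift (ih (by omega) hV0 fun h => ht (by
        rw [Nat.cast_mul]; exact mul_dvd_mul_left _ h))
    · exact hVB.hasSubsum_add hV
        (hasSubsum_of_prime hp hRc (fun h => h0 (hVB.hasSubsum_add hV h)) hpt)

end InverseEGZ

section SubgroupEGZ

variable {N β : Type*} [AddCommGroup N] (K : AddSubgroup N) [IsAddCyclic K] {S : Multiset β}
  {φ : β → N}

theorem exists_sum_eq_zero_of_mem (hφ : ∀ b ∈ S, φ b ∈ K) {k : ℕ} (hk : Nat.card K ∣ k)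
    (h : k + Nat.card K ≤ Multiset.card S + 1) :
    ∃ T ≤ S, Multiset.card T = k ∧ (T.map φ).sum = 0 := by
  obtain ⟨g, rfl⟩ := K.isAddCyclic_iff_exists_zmultiples_eq_top.1 inferInstance
  choose! ψ hψ using fun b hb => AddSubgroup.mem_zmultiples_iff.1 (hφ b hb)
  rw [Nat.card_zmultiples] at hk h
  have hS := hasSubsum_zero_of_dvd (S := S.map ψ) hk (by rwa [Multiset.card_map])
  simpa only [zero_smul] using (hasSubsum_map_iff hψ).1 hS

theorem exists_sum_map_eq_zero [IsAddCyclic N] (φ : β → N) {k : ℕ} (hk : Nat.card N ∣ k)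
    (h : k + Nat.card N ≤ Multiset.card S + 1) :
    ∃ T ≤ S, Multiset.card T = k ∧ (T.map φ).sum = 0 := by
  rw [← AddSubgroup.card_top (G := N)] at hk h
  exact exists_sum_eq_zero_of_mem ⊤ (fun _ _ => AddSubgroup.mem_top _) hk h

theorem exists_sum_eq_zero_of_sub_mem (c : N) (hφ : ∀ b ∈ S, φ b - c ∈ K) {k : ℕ}
    (hc : k • c = 0) (hk : Nat.card K ∣ k) (h : k + Nat.card K ≤ Multiset.card S + 1) :
    ∃ T ≤ S, Multiset.card T = k ∧ (T.map φ).sum = 0 := by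
  obtain ⟨T, hT, rfl, hsum⟩ := exists_sum_eq_zero_of_mem K hφ hk h
  exact ⟨T, hT, rfl, by simpa [Multiset.sum_map_sub, hc] using hsum⟩

theorem exists_sum_eq_of_mem (hφ : ∀ b ∈ S, φ b ∈ K)
    (hS : Multiset.card S + 2 = 2 * Nat.card K)
    (h0 : ∀ T ≤ S, Multiset.card T = Nat.card K → (T.map φ).sum ≠ 0) {t : N} (ht : t ∈ K)
    (ht0 : t ≠ 0) : ∃ T ≤ S, Multiset.card T = Nat.card K ∧ (T.map φ).sum = t := by
  obtain ⟨g, rfl⟩ := K.isAddCyclic_iff_exists_zmultiples_eq_top.1 inferInstance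
  choose! ψ hψ using fun b hb => AddSubgroup.mem_zmultiples_iff.1 (hφ b hb)
  obtain ⟨z, rfl⟩ := AddSubgroup.mem_zmultiples_iff.1 ht
  rw [Nat.card_zmultiples] at hS h0 ⊢
  rw [ne_eq, ← addOrderOf_dvd_iff_zsmul_eq_zero] at ht0
  refine (hasSubsum_map_iff hψ).1 (hasSubsum_of_not_dvd (by rwa [Multiset.card_map]) ?_ ht0)
  rw [hasSubsum_map_iff hψ]
  push Not
  simpa only [zero_smul] using h0

end SubgroupEGZ

section Products

variable {G : Type*} [Group G]

theorem one_mem_products_zero : (1 : G) ∈ products (0 : Multiset G) := ⟨[], rfl, rfl⟩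

theorem mem_products_singleton (g : G) : g ∈ products {g} := ⟨[g], rfl, List.prod_singleton⟩

theorem mul_mem_products {S T : Multiset G} {g h : G} (hg : g ∈ products S)
    (hh : h ∈ products T) : g * h ∈ products (S + T) := by
  obtain ⟨k, rfl, rfl⟩ := hg
  obtain ⟨l, rfl, rfl⟩ := hh
  exact ⟨k ++ l, rfl, List.prod_append⟩

end Products

/-- A parametrisation of the elements of `G` as `y a` and `x * y a` with `a` in an abelian group
`N`, where `x` is an involution acting on `y a` by the involution `σ` of `N`. The sequences over
`G` are studied through sequences of names `(false, a)` of `y a` and `(true, a)` of `x * y a`;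
neither injectivity nor surjectivity of this naming is required here. -/
structure InvolutionFrame (G N : Type*) [Group G] [AddCommGroup N] where
  y : N → G
  x : G
  σ : N →+ N
  y_add : ∀ a b, y (a + b) = y a * y b
  x_mul_x : x * x = 1
  y_mul_x : ∀ a, y a * x = x * y (σ a)
  σ_σ : ∀ a, σ (σ a) = a

namespace InvolutionFrame

variable {G N : Type*} [Group G] [AddCommGroup N] (F : InvolutionFrame G N)

theorem y_zero : F.y 0 = 1 := by simpa using F.y_add 0 0

/-- The element of `G` named by a pair. -/
def eval (t : Bool × N) : G := if t.1 then F.x * F.y t.2 else F.y t.2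

@[simp] theorem eval_false (a : N) : F.eval (false, a) = F.y a := rfl

@[simp] theorem eval_true (a : N) : F.eval (true, a) = F.x * F.y a := rfl

/-- The terms named by `T` can be ordered so that their product is `y c`. -/
def HasProduct (T : Multiset (Bool × N)) (c : N) : Prop := F.y c ∈ products (T.map F.eval)

variable {F}

theorem HasProduct.isProductOne {T : Multiset (Bool × N)} (h : F.HasProduct T 0) :
    IsProductOne (T.map F.eval) := by
  rwa [HasProduct, y_zero] at h

theorem HasProduct.add {T U : Multiset (Bool × N)} {c d : N} (hT : F.HasProduct T c)
    (hU : F.HasProduct U d) : F.HasProduct (T + U) (c + d) := by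
  rw [HasProduct, Multiset.map_add, F.y_add]
  exact mul_mem_products hT hU

theorem hasProduct_zero : F.HasProduct 0 0 := by
  simpa only [HasProduct, y_zero, Multiset.map_zero] using one_mem_products_zero

theorem hasProduct_singleton (a : N) : F.HasProduct {(false, a)} a :=
  mem_products_singleton (F.y a)

theorem hasProduct_map_false (A : Multiset N) : F.HasProduct (A.map (Prod.mk false)) A.sum := by
  induction A using Multiset.induction with
  | empty => exact hasProduct_zero
  | cons a A ih =>
    rw [Multiset.map_cons, Multiset.sum_cons, ← Multiset.singleton_add]
    exact (hasProduct_singleton a).add ih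

/-- Terms placed between two terms outside of `y N` are twisted by `σ`. -/
theorem HasProduct.flip {T U : Multiset (Bool × N)} {c d : N} (b b' : N) (hT : F.HasProduct T c)
    (hU : F.HasProduct U d) :
    F.HasProduct ({(true, b), (true, b')} + (T + U)) (F.σ b + b' + F.σ c + d) := by
  have h := mul_mem_products (mul_mem_products (mem_products_singleton (F.eval (true, b))) hT)
    (mul_mem_products (mem_products_singleton (F.eval (true, b'))) hU)
  have hterms : ({(true, b), (true, b')} + (T + U)).map F.eval =
      {F.eval (true, b)} + T.map F.eval + ({F.eval (true, b')} + U.map F.eval) := by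
    simp only [Multiset.map_add, Multiset.insert_eq_cons, Multiset.map_singleton,
      ← Multiset.singleton_add]
    abel
  rw [HasProduct, hterms]
  convert h using 1
  calc F.y (F.σ b + b' + F.σ c + d) = F.y (F.σ (b + c) + (b' + d)) := by
        rw [map_add]; congr 1; abel
    _ = F.x * F.x * F.y (F.σ (b + c)) * F.y (b' + d) := by rw [F.x_mul_x, one_mul, F.y_add]
    _ = F.x * (F.y (b + c) * F.x) * F.y (b' + d) := by rw [F.y_mul_x, mul_assoc F.x F.x]
    _ = F.x * F.y b * F.y c * (F.x * F.y b' * F.y d) := by simp only [F.y_add, mul_assoc]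

theorem hasProduct_pair_true (b b' : N) :
    F.HasProduct {(true, b), (true, b')} (F.σ b + b') := by
  simpa using HasProduct.flip b b' hasProduct_zero (hasProduct_zero (F := F))

variable (F) in
/-- The parameter of the product of two terms that lie in the same coset of `y N`. -/
def pairProd (q : (Bool × N) × (Bool × N)) : N :=
  if q.1.1 then F.σ q.1.2 + q.2.2 else q.1.2 + q.2.2

theorem hasProduct_flatten (Q : Multiset ((Bool × N) × (Bool × N)))
    (hQ : ∀ q ∈ Q, q.1.1 = q.2.1) : F.HasProduct (flatten Q) (Q.map F.pairProd).sum := by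
  induction Q using Multiset.induction with
  | empty => exact hasProduct_zero
  | cons q Q ih =>
    rw [Multiset.forall_mem_cons] at hQ
    rw [flatten_cons, ← Multiset.singleton_add q.1, ← Multiset.singleton_add q.2, ← add_assoc,
      Multiset.map_cons, Multiset.sum_cons]
    refine HasProduct.add ?_ (ih hQ.2)
    obtain ⟨⟨e, a⟩, e', a'⟩ := q
    obtain rfl : e = e' := hQ.1
    cases e
    · exact (hasProduct_singleton a).add (hasProduct_singleton a')
    · exact hasProduct_pair_true a a'

theorem exists_hasProduct_zero_of_pairs (K : AddSubgroup N) [IsAddCyclic K]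
    {Q : Multiset ((Bool × N) × (Bool × N))} (hQ : ∀ q ∈ Q, q.1.1 = q.2.1)
    (hK : ∀ q ∈ Q, F.pairProd q ∈ K) {k : ℕ} (hk : Nat.card K ∣ k)
    (h : k + Nat.card K ≤ Multiset.card Q + 1) :
    ∃ T ≤ flatten Q, Multiset.card T = 2 * k ∧ F.HasProduct T 0 := by
  obtain ⟨P, hP, hPc, hPs⟩ := exists_sum_eq_zero_of_mem K hK hk h
  refine ⟨flatten P, flatten_mono hP, by rw [card_flatten, hPc], ?_⟩
  rw [← hPs]
  exact hasProduct_flatten P fun q hq => hQ q (Multiset.mem_of_le hP hq)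

theorem hasProductOneSub (hF : Function.Surjective F.eval) {k L : ℕ}
    (h : ∀ S : Multiset (Bool × N), Multiset.card S = L →
      ∃ T ≤ S, Multiset.card T = k ∧ F.HasProduct T 0)
    {S : Multiset G} (hS : L ≤ Multiset.card S) : HasProductOneSub k S := by
  obtain ⟨S', hS'S, hS'⟩ := exists_le_card_eq hS
  obtain ⟨S', rfl⟩ := Multiset.map_surjective_of_surjective hF S'
  obtain ⟨T, hTS', rfl, hT⟩ := h S' (by simpa using hS')
  exact ⟨T.map F.eval, (Multiset.map_le_map hTS').trans hS'S, Multiset.card_map _ _,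
    hT.isProductOne⟩

/-- The frame with the parameters renamed along an isomorphism. -/
def comap {N' : Type*} [AddCommGroup N'] (F : InvolutionFrame G N) (e : N' ≃+ N) :
    InvolutionFrame G N' where
  y a := F.y (e a)
  x := F.x
  σ := e.symm.toAddMonoidHom.comp (F.σ.comp e.toAddMonoidHom)
  y_add a b := by rw [map_add, F.y_add]
  x_mul_x := F.x_mul_x
  y_mul_x a := by simp [F.y_mul_x]
  σ_σ a := by simp [F.σ_σ]

theorem comap_eval_surjective {N' : Type*} [AddCommGroup N'] (e : N' ≃+ N)
    (hF : Function.Surjective F.eval) : Function.Surjective (F.comap e).eval := by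
  intro g
  obtain ⟨⟨b, a⟩, rfl⟩ := hF g
  exact ⟨(b, e.symm a), by cases b <;> simp [comap]⟩

end InvolutionFrame

namespace InvolutionFrame

section ParityCharacter

variable {G N : Type*} [Group G] [AddCommGroup N] {F : InvolutionFrame G N} {par : N →+ ZMod 2}

theorem pairProd_mem_ker (hσ : ∀ a, par (F.σ a) = par a) {q : (Bool × N) × (Bool × N)}
    (h : par q.1.2 = par q.2.2) : F.pairProd q ∈ par.ker := by
  rw [AddMonoidHom.mem_ker, pairProd]
  split_ifs <;> simp [hσ, h, CharTwo.add_self_eq_zero]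

theorem two_mul_card_ker (hpar : Function.Surjective par) :
    2 * Nat.card par.ker = Nat.card N := by
  have h := AddSubgroup.card_mul_index par.ker
  rwa [AddSubgroup.index_ker, AddMonoidHom.range_eq_top.2 hpar, AddSubgroup.card_top,
    Nat.card_zmod, mul_comm] at h

theorem two_mul_card_fixed_le [Finite N] {a : N} (ha : par a ≠ 0) (haσ : F.σ a = a)
    (hne : ∃ b, F.σ b ≠ b) :
    2 * Nat.card ↥(par.ker ⊓ F.σ.eqLocus (AddMonoidHom.id N)) ≤ Nat.card par.ker := by
  have hle : par.ker ⊓ F.σ.eqLocus (AddMonoidHom.id N) ≤ par.ker := inf_le_left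
  obtain ⟨j, hj⟩ := AddSubgroup.card_dvd_of_le hle
  have hpos : 0 < Nat.card par.ker := Nat.card_pos
  have hj2 : 2 ≤ j := by
    by_contra! hj2
    have hker : par.ker ≤ F.σ.eqLocus (AddMonoidHom.id N) :=
      inf_eq_left.1 (AddSubgroup.eq_of_le_of_card_ge hle (by interval_cases j <;> omega))
    have hone : ∀ z : ZMod 2, z ≠ 0 → z = 1 := by decide
    obtain ⟨b, hb⟩ := hne
    by_cases hpb : par b = 0
    · exact hb (hker hpb)
    · have hba : F.σ (b - a) = b - a := hker <| by
        rw [AddMonoidHom.mem_ker, map_sub, hone _ hpb, hone _ ha, sub_self]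
      rw [map_sub, haσ] at hba
      exact hb (sub_left_injective hba)
  rw [hj, mul_comm]
  gcongr

theorem fixed_of_hasProduct_unique {a a' b b' v : N} (hpar : par (a + a' + (b + b')) = 0)
    (hσ : ∀ a, par (F.σ a) = par a)
    (h : ∀ w, par w = 0 →
      F.HasProduct {(false, a), (false, a'), (true, b), (true, b')} w → w = v) :
    F.σ a = a ∧ F.σ a' = a' ∧ F.σ b - b = F.σ b' - b' := by
  simp only [map_add] at hpar
  have hsum : F.σ b + b' + (a + a') = v := by
    refine h _ (by simp only [map_add, hσ]; linear_combination hpar) ?_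
    convert HasProduct.flip b b' hasProduct_zero
      ((hasProduct_singleton a).add (hasProduct_singleton a')) using 1
    · simp only [Multiset.insert_eq_cons, ← Multiset.singleton_add]; abel
    · simp
  have hsum_a : F.σ b + b' + F.σ a + a' = v := by
    refine h _ (by simp only [map_add, hσ]; linear_combination hpar) ?_
    convert HasProduct.flip b b' (hasProduct_singleton a) (hasProduct_singleton a') using 1
    simp only [Multiset.insert_eq_cons, ← Multiset.singleton_add]; abel
  have hsum_a' : F.σ b + b' + F.σ a' + a = v := by
    refine h _ (by simp only [map_add, hσ]; linear_combination hpar) ?_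
    convert HasProduct.flip b b' (hasProduct_singleton a') (hasProduct_singleton a) using 1
    simp only [Multiset.insert_eq_cons, ← Multiset.singleton_add]; abel
  have hsum_b' : F.σ b' + b + (a + a') = v := by
    refine h _ (by simp only [map_add, hσ]; linear_combination hpar) ?_
    convert HasProduct.flip b' b hasProduct_zero
      ((hasProduct_singleton a).add (hasProduct_singleton a')) using 1
    · simp only [Multiset.insert_eq_cons, ← Multiset.singleton_add]; abel
    · simp
  refine ⟨?_, ?_, ?_⟩ <;> grind

variable [IsAddCyclic N]

/-- Below the threshold of the Erdős–Ginzburg–Ziv theorem, the pairs represent every non-zero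
element of `ker par`, so that four further terms can complete them in at most one way. -/
theorem eq_neg_sum_of_hasProduct (hσ : ∀ a, par (F.σ a) = par a)
    (hpar : Function.Surjective par) {Q : Multiset ((Bool × N) × (Bool × N))}
    {U : Multiset (Bool × N)} (hQ : ∀ q ∈ Q, q.1.1 = q.2.1 ∧ par q.1.2 = par q.2.2)
    (hQc : Multiset.card Q + 2 = 2 * Nat.card par.ker) (hU : Multiset.card U = 4)
    (hno : ¬ ∃ T ≤ flatten Q + U, Multiset.card T = Nat.card N ∧ F.HasProduct T 0) {w : N}
    (hw0 : par w = 0) (hw : F.HasProduct U w) : w = -(Q.map F.pairProd).sum := by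
  have hker : ∀ q ∈ Q, F.pairProd q ∈ par.ker := fun q hq => pairProd_mem_ker hσ (hQ q hq).2
  have hflatten : ∀ T ≤ Q, F.HasProduct (flatten T) (T.map F.pairProd).sum :=
    fun T hT => hasProduct_flatten T fun q hq => (hQ q (Multiset.mem_of_le hT hq)).1
  have h0 : ∀ T ≤ Q, Multiset.card T = Nat.card par.ker → (T.map F.pairProd).sum ≠ 0 :=
    fun T hT hTc hT0 => hno ⟨flatten T, (flatten_mono hT).trans (Multiset.le_add_right _ _),
      by rw [card_flatten, hTc, two_mul_card_ker hpar], hT0 ▸ hflatten T hT⟩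
  have hsum : (Q.map F.pairProd).sum ∈ par.ker :=
    multiset_sum_mem _ fun v hv => by
      obtain ⟨q, hq, rfl⟩ := Multiset.mem_map.1 hv
      exact hker q hq
  by_contra hne
  obtain ⟨T, hT, hTc, hTs⟩ := exists_sum_eq_of_mem par.ker hker hQc h0 (add_mem hsum hw0)
    (fun h => hne (eq_neg_of_add_eq_zero_right h))
  obtain ⟨R, rfl⟩ := Multiset.le_iff_exists_add.1 hT
  refine hno ⟨flatten R + U, by gcongr; exact flatten_mono (Multiset.le_add_left _ _), ?_, ?_⟩
  · rw [Multiset.card_add] at hQc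
    rw [Multiset.card_add, card_flatten, hU, ← two_mul_card_ker hpar]
    omega
  · convert (hflatten R (Multiset.le_add_left _ _)).add hw using 1
    rw [Multiset.map_add, Multiset.sum_add] at hTs
    grind

/-- The classes of the terms modulo the subgroup of `G` named by `(false, a)` with `par a = 0`. -/
def parityClass (par : N →+ ZMod 2) (t : Bool × N) : Bool × ZMod 2 := (t.1, par t.2)

variable {S : Multiset (Bool × N)} {Q : Multiset ((Bool × N) × (Bool × N))}
  {r : Bool × ZMod 2 → Bool × N}

theorem fixed_of_isCompletePairing (hσ : ∀ a, par (F.σ a) = par a)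
    (hpar : Function.Surjective par) (hS : Multiset.card S = 2 * Nat.card N)
    (hno : ¬ ∃ T ≤ S, Multiset.card T = Nat.card N ∧ F.HasProduct T 0)
    (h : IsCompletePairing (parityClass par) S Q r) :
    (∀ i, F.σ (r (false, i)).2 = (r (false, i)).2) ∧
      ∀ i j, F.σ (r (true, i)).2 - (r (true, i)).2 = F.σ (r (true, j)).2 - (r (true, j)).2 := by
  have hfst (p) : (r p).1 = p.1 := congrArg Prod.fst (h.map_rep p)
  have hsnd (p) : par (r p).2 = p.2 := congrArg Prod.snd (h.map_rep p)
  have hU : Finset.univ.val.map r = {(false, (r (false, 0)).2), (false, (r (false, 1)).2),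
      (true, (r (true, 0)).2), (true, (r (true, 1)).2)} := by
    have hr (e i) : (e, (r (e, i)).2) = r (e, i) := Prod.ext (hfst (e, i)).symm rfl
    have huniv : (Finset.univ : Finset (Bool × ZMod 2)).val =
      {(false, 0), (false, 1), (true, 0), (true, 1)} := by decide
    simp only [hr, huniv]
    rfl
  obtain ⟨h0, h1, h2⟩ := fixed_of_hasProduct_unique (F := F) (par := par)
    (a := (r (false, 0)).2) (a' := (r (false, 1)).2) (b := (r (true, 0)).2)
    (b' := (r (true, 1)).2) (v := -(Q.map F.pairProd).sum)
    (by simp only [map_add, hsnd]; decide) hσ fun w hw0 hw => by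
      refine eq_neg_sum_of_hasProduct hσ hpar (fun q hq => Prod.ext_iff.1 (h.map_fst_eq q hq))
        ?_ rfl ?_ hw0 hw
      · have := congrArg Multiset.card h.flatten_add
        simp only [Multiset.card_add, card_flatten, hU, hS, ← two_mul_card_ker hpar,
          Multiset.insert_eq_cons, Multiset.card_cons, Multiset.card_singleton] at this
        omega
      · rwa [← hU, h.flatten_add]
  exact ⟨fun i => by fin_cases i <;> assumption,
    fun i j => by fin_cases i <;> fin_cases j <;> first | rfl | exact h2 | exact h2.symm⟩

theorem fixed_of_mem_flatten (hσ : ∀ a, par (F.σ a) = par a)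
    (hpar : Function.Surjective par) (hS : Multiset.card S = 2 * Nat.card N)
    (hno : ¬ ∃ T ≤ S, Multiset.card T = Nat.card N ∧ F.HasProduct T 0)
    (h : IsCompletePairing (parityClass par) S Q r) {c : N} :
    ((false, c) ∈ flatten Q → F.σ c = c) ∧
      ((true, c) ∈ flatten Q → F.σ c - c = F.σ (r (true, 0)).2 - (r (true, 0)).2) := by
  have hfix := fixed_of_isCompletePairing hσ hpar hS hno h
  refine ⟨fun hc => ?_, fun hc => ?_⟩ <;> obtain ⟨Q', h'⟩ := h.exists_update hc
  · simpa [parityClass] using (fixed_of_isCompletePairing hσ hpar hS hno h').1 (par c)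
  · have := (fixed_of_isCompletePairing hσ hpar hS hno h').2 (par c) (par c + 1)
    simp only [parityClass, Function.update_self, ne_eq, Prod.mk.injEq, add_eq_left, one_ne_zero,
      and_false, not_false_eq_true, Function.update_of_ne] at this
    exact this.trans (hfix.2 _ _)

theorem σ_pairProd_of_mem (hσ : ∀ a, par (F.σ a) = par a)
    (hpar : Function.Surjective par) (hS : Multiset.card S = 2 * Nat.card N)
    (hno : ¬ ∃ T ≤ S, Multiset.card T = Nat.card N ∧ F.HasProduct T 0)
    (h : IsCompletePairing (parityClass par) S Q r) {q : (Bool × N) × (Bool × N)} (hq : q ∈ Q) :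
    F.σ (F.pairProd q) = F.pairProd q := by
  have hfix (c) := fixed_of_mem_flatten (c := c) hσ hpar hS hno h
  obtain ⟨⟨e, a⟩, e', a'⟩ := q
  obtain rfl : e = e' := congrArg Prod.fst (h.map_fst_eq _ hq)
  have ha : (e, a) ∈ flatten Q := Multiset.mem_add.2 (.inl (Multiset.mem_map.2 ⟨_, hq, rfl⟩))
  have ha' : (e, a') ∈ flatten Q := Multiset.mem_add.2 (.inr (Multiset.mem_map.2 ⟨_, hq, rfl⟩))
  cases e
  · simp [pairProd, (hfix _).1 ha, (hfix _).1 ha']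
  · have := ((hfix _).2 ha).trans ((hfix _).2 ha').symm
    simp only [pairProd, if_true, map_add, F.σ_σ]
    grind

theorem exists_hasProduct_card [Finite N] (hσ : ∀ a, par (F.σ a) = par a)
    (hpar : Function.Surjective par) (hne : ∃ a, F.σ a ≠ a)
    (hS : Multiset.card S = 2 * Nat.card N) :
    ∃ T ≤ S, Multiset.card T = Nat.card N ∧ F.HasProduct T 0 := by
  by_contra hno
  have hM := two_mul_card_ker hpar
  have hpairs {Q : Multiset ((Bool × N) × (Bool × N))} (hQS : flatten Q ≤ S)
      (hQ : ∀ q ∈ Q, parityClass par q.1 = parityClass par q.2) {K : AddSubgroup N}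
      (hK : K ≤ par.ker) (hQK : ∀ q ∈ Q, F.pairProd q ∈ K) :
      ¬ Nat.card par.ker + Nat.card K ≤ Multiset.card Q + 1 := by
    intro h
    obtain ⟨T, hT, hTc, hT0⟩ := exists_hasProduct_zero_of_pairs K
      (fun q hq => (Prod.ext_iff.1 (hQ q hq)).1) hQK (AddSubgroup.card_dvd_of_le hK) h
    exact hno ⟨T, hT.trans hQS, hTc.trans hM, hT0⟩
  have hker {Q : Multiset ((Bool × N) × (Bool × N))}
      (hQ : ∀ q ∈ Q, parityClass par q.1 = parityClass par q.2) : ∀ q ∈ Q, F.pairProd q ∈ par.ker :=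
    fun q hq => pairProd_mem_ker hσ (congrArg Prod.snd (hQ q hq))
  obtain ⟨Q, r, h⟩ | ⟨Q, hQS, hQ, hQc⟩ := exists_isCompletePairing_or (parityClass par) S
  · have hcard : 2 * Multiset.card Q + 4 = Multiset.card S := by
      simpa using congrArg Multiset.card h.flatten_add
    have hodd : par (r (false, 1)).2 = 1 := congrArg Prod.snd (h.map_rep (false, 1))
    have hfixed := two_mul_card_fixed_le (F := F) (par := par) (by simp [hodd])
      ((fixed_of_isCompletePairing hσ hpar hS hno h).1 1) hne
    refine hpairs (h.flatten_add ▸ Multiset.le_add_right _ _) h.map_fst_eq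
      (K := par.ker ⊓ F.σ.eqLocus (AddMonoidHom.id N)) inf_le_left (fun q hq =>
        ⟨hker h.map_fst_eq q hq, σ_pairProd_of_mem hσ hpar hS hno h hq⟩) (by omega)
  · have hclasses : Fintype.card (Bool × ZMod 2) = 4 := rfl
    exact hpairs hQS hQ le_rfl (hker hQ) (by omega)

end ParityCharacter

end InvolutionFrame

section SubsetSums

open AddAction (stabilizer mem_stabilizer_iff mem_stabilizer_set_iff_vadd_set_subset)

variable {H : Type*} [AddCommGroup H]

/-- The set of the sums of all sub-multisets of `D`, the empty one included. -/
def subsetSums (D : Multiset H) : Set H := {h | ∃ T ≤ D, T.sum = h}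

theorem subsetSums_mono {D E : Multiset H} (h : D ≤ E) : subsetSums D ⊆ subsetSums E :=
  fun _ ⟨T, hT, hTh⟩ => ⟨T, hT.trans h, hTh⟩

theorem subsetSums_nonempty (D : Multiset H) : (subsetSums D).Nonempty :=
  ⟨0, 0, Multiset.zero_le D, rfl⟩

theorem subsetSums_cons (d : H) (D : Multiset H) :
    subsetSums (d ::ₘ D) = subsetSums D ∪ (d +ᵥ subsetSums D) := by
  ext h
  simp only [subsetSums, le_cons_iff, Set.mem_union, Set.mem_vadd_set, Set.mem_ofPred_eq,
    vadd_eq_add]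
  constructor
  · rintro ⟨_, hT | ⟨T, hT, rfl⟩, rfl⟩
    · exact .inl ⟨_, hT, rfl⟩
    · exact .inr ⟨_, ⟨T, hT, rfl⟩, (Multiset.sum_cons d T).symm⟩
  · rintro (⟨T, hT, rfl⟩ | ⟨_, ⟨T, hT, rfl⟩, rfl⟩)
    · exact ⟨T, .inl hT, rfl⟩
    · exact ⟨_, .inr ⟨T, hT, rfl⟩, Multiset.sum_cons d T⟩

theorem stabilizer_subsetSums_le_cons (d : H) (D : Multiset H) :
    stabilizer H (subsetSums D) ≤ stabilizer H (subsetSums (d ::ₘ D)) := by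
  intro e he
  rw [mem_stabilizer_iff] at he ⊢
  rw [subsetSums_cons, Set.vadd_set_union, vadd_comm e d, he]

theorem card_stabilizer_add_ncard_le [Finite H] {X : Set H} (hX : X ≠ Set.univ) :
    Nat.card (stabilizer H X) + X.ncard ≤ Nat.card H := by
  obtain ⟨h, hh⟩ := (Set.ne_univ_iff_exists_notMem X).1 hX
  have hdisj : h +ᵥ (stabilizer H X : Set H) ⊆ Xᶜ := by
    rintro _ ⟨e, he, rfl⟩ hX
    have he' := (stabilizer H X).neg_mem he
    rw [mem_stabilizer_iff] at he'
    apply hh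
    rw [← he']
    exact ⟨_, hX, by simp⟩
  calc Nat.card (stabilizer H X) + X.ncard
      = (h +ᵥ (stabilizer H X : Set H)).ncard + X.ncard := by
        rw [Set.ncard_vadd_set, ← Nat.card_coe_set_eq]; rfl
    _ ≤ Xᶜ.ncard + X.ncard := by gcongr; exact Set.toFinite _
    _ = Nat.card H := Set.ncard_compl_add_ncard X

theorem ncard_subsetSums_lt_cons [Finite H] {d : H} {D : Multiset H}
    (hd : d ∉ stabilizer H (subsetSums D)) :
    (subsetSums D).ncard < (subsetSums (d ::ₘ D)).ncard := by
  rw [subsetSums_cons]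
  refine Set.ncard_lt_ncard ⟨Set.subset_union_left, fun h => hd ?_⟩
  exact (mem_stabilizer_set_iff_vadd_set_subset (Set.toFinite _)).2
    (Set.subset_union_right.trans h)

open Classical in
theorem card_filter_notMem_lt_ncard_subsetSums [Finite H] (K : AddSubgroup H) (D : Multiset H)
    (h : stabilizer H (subsetSums D) ≤ K) :
    Multiset.card (D.filter (· ∉ K)) < (subsetSums D).ncard := by
  induction D using Multiset.induction with
  | empty => exact (subsetSums_nonempty 0).ncard_pos
  | cons d D ih =>
    have hD := (stabilizer_subsetSums_le_cons d D).trans h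
    by_cases hd : d ∈ K
    · rw [Multiset.filter_cons_of_neg (p := (· ∉ K)) _ (not_not.2 hd)]
      exact (ih hD).trans_le
        (Set.ncard_le_ncard (subsetSums_mono (Multiset.le_cons_self _ _)))
    · rw [Multiset.filter_cons_of_pos (p := (· ∉ K)) _ hd, Multiset.card_cons]
      exact lt_of_le_of_lt (ih hD) (ncard_subsetSums_lt_cons fun hdD => hd (hD hdD))

theorem exists_choice_of_mem_subsetSums {α : Type*} {φ : α → H} {Q : Multiset (α × α)} {t : H}
    (h : t ∈ subsetSums (Q.map fun q => φ q.2 - φ q.1)) :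
    ∃ T ≤ flatten Q, Multiset.card T = Multiset.card Q ∧
      (T.map φ).sum = (Q.map fun q => φ q.1).sum + t := by
  obtain ⟨P, hP, rfl⟩ := exists_le_map_iff.1 h
  obtain ⟨R, rfl⟩ := Multiset.le_iff_exists_add.1 hP
  refine ⟨R.map Prod.fst + P.map Prod.snd, ?_, by simp [add_comm], ?_⟩
  · exact add_le_add (Multiset.map_le_map (Multiset.le_add_left _ _)) (Multiset.map_le_map hP)
  · simp only [Multiset.map_add, Multiset.map_map, Multiset.sum_add, Multiset.sum_map_sub,
      Function.comp_def]
    abel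

end SubsetSums

section Subgroups

variable {M L : Type*} [AddCommGroup M] [AddCommGroup L]

theorem card_prod_top (K : AddSubgroup M) :
    Nat.card (K.prod (⊤ : AddSubgroup L)) = Nat.card K * Nat.card L := by
  rw [Nat.card_congr (K.prodEquiv ⊤).toEquiv, Nat.card_prod, AddSubgroup.card_top]

theorem card_top_prod (K : AddSubgroup L) :
    Nat.card ((⊤ : AddSubgroup M).prod K) = Nat.card M * Nat.card K := by
  rw [Nat.card_congr (AddSubgroup.prodEquiv ⊤ K).toEquiv, Nat.card_prod, AddSubgroup.card_top]

theorem snd_multiset_sum (S : Multiset (M × L)) : S.sum.2 = (S.map Prod.snd).sum :=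
  map_multiset_sum (AddMonoidHom.snd M L) S

theorem three_le_index [Finite M] (hM : Odd (Nat.card M)) {K : AddSubgroup M} (hK : K ≠ ⊤) :
    3 ≤ K.index := by
  obtain ⟨j, hj⟩ := hM.of_dvd_nat K.index_dvd_card
  have hK1 : K.index ≠ 1 := fun h => hK (AddSubgroup.index_eq_one.1 h)
  omega

theorem mem_of_neg_add_self_mem [Finite M] (hM : Odd (Nat.card M)) (K : AddSubgroup M) {a : M}
    (ha : -(a + a) ∈ K) : a ∈ K := by
  obtain ⟨j, hj⟩ := hM
  have hdouble : (j + 1) • (a + a) = a := by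
    rw [← two_nsmul, ← mul_nsmul, show 2 * (j + 1) = Nat.card M + 1 by omega, succ_nsmul,
      card_nsmul_eq_zero', zero_add]
  rw [← hdouble]
  exact K.nsmul_mem (neg_mem_iff.1 ha) _

theorem stabilizer_ne_top [Finite M] {X : Set M} (hX : X.Nonempty) (hXu : X ≠ Set.univ) :
    AddAction.stabilizer M X ≠ ⊤ := by
  intro h
  have hcard := card_stabilizer_add_ncard_le hXu
  rw [h, AddSubgroup.card_top] at hcard
  have := hX.ncard_pos
  omega

end Subgroups

/-- The sequence of the names `(false, a)` for `a` in `A` and `(true, b)` for `b` in `B`. -/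
def terms {N : Type*} (A B : Multiset N) : Multiset (Bool × N) :=
  A.map (Prod.mk false) + B.map (Prod.mk true)

section Terms

variable {N : Type*} {A A' B B' : Multiset N}

theorem exists_eq_terms (S : Multiset (Bool × N)) : ∃ A B, S = terms A B := by
  induction S using Multiset.induction with
  | empty => exact ⟨0, 0, rfl⟩
  | cons t S ih =>
    obtain ⟨A, B, rfl⟩ := ih
    obtain ⟨_ | _, a⟩ := t
    · exact ⟨a ::ₘ A, B, by simp [terms]⟩
    · exact ⟨A, a ::ₘ B, by simp [terms]⟩

@[simp] theorem card_terms : Multiset.card (terms A B) = Multiset.card A + Multiset.card B := by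
  simp [terms]

theorem terms_mono (hA : A ≤ A') (hB : B ≤ B') : terms A B ≤ terms A' B' :=
  add_le_add (Multiset.map_le_map hA) (Multiset.map_le_map hB)

end Terms

namespace InvolutionFrame

variable {G : Type*} [Group G]

theorem hasProduct_flip_flatten {N : Type*} [AddCommGroup N] {F : InvolutionFrame G N}
    (b b' : N) (Q : Multiset ((Bool × N) × (Bool × N))) (hQ : ∀ q ∈ Q, q.1.1 = q.2.1) :
    F.HasProduct ((true, b) ::ₘ (true, b') ::ₘ flatten Q)
      (F.σ b + b' + (Q.map fun q => F.σ q.1.2 + q.2.2).sum) := by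
  -- A pair in `y N` is separated by the second of the two terms `x * y b`, `x * y b'`.
  obtain ⟨T, U, c, d, hTU, hT, hU, hcd⟩ : ∃ T U c d, flatten Q = T + U ∧ F.HasProduct T c ∧
      F.HasProduct U d ∧ F.σ c + d = (Q.map fun q => F.σ q.1.2 + q.2.2).sum := by
    induction Q using Multiset.induction with
    | empty => exact ⟨0, 0, 0, 0, rfl, hasProduct_zero, hasProduct_zero, by simp⟩
    | cons q Q ih =>
      rw [Multiset.forall_mem_cons] at hQ
      obtain ⟨T, U, c, d, hTU, hT, hU, hcd⟩ := ih hQ.2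
      obtain ⟨⟨e, a⟩, e', a'⟩ := q
      obtain rfl : e = e' := hQ.1
      rw [flatten_cons, hTU, Multiset.map_cons, Multiset.sum_cons, ← hcd]
      simp only [← Multiset.singleton_add]
      cases e
      · exact ⟨_, _, _, _, by abel, (hasProduct_singleton a).add hT,
          (hasProduct_singleton a').add hU, by rw [map_add]; abel⟩
      · exact ⟨_, _, _, _, by rw [Multiset.insert_eq_cons, ← Multiset.singleton_add]; abel, hT,
          (hasProduct_pair_true a a').add hU, by abel⟩
  have h := hT.flip b b' hU
  rwa [← hTU, add_assoc (F.σ b + b'), hcd, Multiset.insert_eq_cons, Multiset.cons_add,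
    Multiset.singleton_add] at h

section OddOrder

variable {M L : Type*} [AddCommGroup M] [AddCommGroup L] {F : InvolutionFrame G (M × L)}

theorem exists_hasProduct_zero_of_true_pair [Finite M] [Finite L] [IsAddCyclic (M × L)]
    (hσ : ∀ a, F.σ a = (-a.1, a.2))
    {Q₁ Q₂ : Multiset ((Bool × M × L) × (Bool × M × L))} (hQ₁ : ∀ q ∈ Q₁, q.1.1 = true)
    (hQ : ∀ q ∈ Q₁ + Q₂, q.1.1 = q.2.1 ∧ q.1.2.1 = q.2.2.1)
    (hQ₂ : Multiset.card Q₂ < Nat.card M * Nat.card L)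
    (h : Nat.card M * Nat.card L + Nat.card L ≤ Multiset.card (Q₁ + Q₂) + 1) :
    ∃ T ≤ flatten (Q₁ + Q₂), Multiset.card T = 2 * (Nat.card M * Nat.card L) ∧
      F.HasProduct T 0 := by
  have hK : ∀ q ∈ Q₁ + Q₂, F.σ q.1.2 + q.2.2 ∈ (⊥ : AddSubgroup M).prod (⊤ : AddSubgroup L) := by
    intro q hq
    simp [AddSubgroup.mem_prod, hσ, (hQ q hq).2]
  have hKcard : Nat.card ((⊥ : AddSubgroup M).prod (⊤ : AddSubgroup L)) = Nat.card L := by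
    rw [card_prod_top, AddSubgroup.card_bot, one_mul]
  obtain ⟨W, hWQ, hW, hWsum⟩ := exists_sum_eq_zero_of_mem _ hK
    (k := Nat.card M * Nat.card L) (hKcard ▸ dvd_mul_left _ _) (hKcard.symm ▸ h)
  obtain ⟨q, hqW, hq⟩ : ∃ q ∈ W, q ∈ Q₁ := by
    obtain ⟨W₁, hW₁, W₂, hW₂, rfl⟩ := exists_eq_add_of_le_add hWQ
    have hW₂card := Multiset.card_le_card hW₂
    obtain ⟨q, hq⟩ := Multiset.card_pos_iff_exists_mem.1 (show 0 < Multiset.card W₁ by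
      rw [Multiset.card_add] at hW
      omega)
    exact ⟨q, Multiset.mem_add.2 (.inl hq), Multiset.mem_of_le hW₁ hq⟩
  refine ⟨flatten W, flatten_mono hWQ, by rw [card_flatten, hW], ?_⟩
  obtain ⟨V, rfl⟩ := Multiset.exists_cons_of_mem hqW
  have hV : ∀ p ∈ q ::ₘ V, p.1.1 = p.2.1 := fun p hp => (hQ p (Multiset.mem_of_le hWQ hp)).1
  rw [Multiset.forall_mem_cons] at hV
  obtain ⟨⟨e, b⟩, e', b'⟩ := q
  obtain rfl : e = true := hQ₁ _ hq
  obtain rfl : true = e' := hV.1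
  rw [flatten_cons, ← hWsum, Multiset.map_cons, Multiset.sum_cons]
  exact hasProduct_flip_flatten b b' V hV.2

theorem exists_hasProduct_zero_of_many_true [Finite M] [Finite L] [IsAddCyclic (M × L)]
    (hσ : ∀ a, F.σ a = (-a.1, a.2)) (hM : 3 ≤ Nat.card M) (hL : 3 ≤ Nat.card L)
    {S U : Multiset (Bool × M × L)} (hS : Multiset.card S = 3 * (Nat.card M * Nat.card L))
    (hUS : U ≤ S) (hU : ∀ t ∈ U, t.1 = true)
    (hUcard : Nat.card M + 2 * Nat.card L ≤ Multiset.card U + 1) :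
    ∃ T ≤ S, Multiset.card T = 2 * (Nat.card M * Nat.card L) ∧ F.HasProduct T 0 := by
  classical
  have hML : 2 * Nat.card M + 2 * Nat.card L ≤ Nat.card M * Nat.card L + 3 := by
    nlinarith [Nat.mul_le_mul hM hL]
  obtain ⟨Q, hQU, hQ, hQcard⟩ := exists_pairing_card (fun t : Bool × M × L => t.2.1) U
  obtain ⟨Q₁, hQ₁Q, hQ₁card⟩ :=
    exists_le_card_eq (show Nat.card L ≤ Multiset.card Q by omega)
  have hQ₁U : flatten Q₁ ≤ U := (flatten_mono hQ₁Q).trans hQU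
  have hQ₁true (q) (hq : q ∈ Q₁) : q.1.1 = true ∧ q.2.1 = true :=
    ⟨hU _ (Multiset.mem_of_le hQ₁U (fst_mem_flatten hq)),
      hU _ (Multiset.mem_of_le hQ₁U (snd_mem_flatten hq))⟩
  obtain ⟨P, hPS, hP, hPcard⟩ :=
    exists_pairing_card (fun t : Bool × M × L => (t.1, t.2.1)) (S - flatten Q₁)
  rw [Multiset.card_sub (hQ₁U.trans hUS), card_flatten, hQ₁card, hS, Nat.card_prod,
    Nat.card_eq_fintype_card (α := Bool), Fintype.card_bool] at hPcard
  obtain ⟨Q₂, hQ₂P, hQ₂card⟩ :=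
    exists_le_card_eq (show Nat.card M * Nat.card L - 1 ≤ Multiset.card P by omega)
  have hle : flatten (Q₁ + Q₂) ≤ S := by
    rw [flatten_add]
    exact add_le_of_le_tsub (hQ₁U.trans hUS) ((flatten_mono hQ₂P).trans hPS)
  have hclass : ∀ q ∈ Q₁ + Q₂, q.1.1 = q.2.1 ∧ q.1.2.1 = q.2.2.1 := by
    intro q hq
    obtain hq | hq := Multiset.mem_add.1 hq
    · exact ⟨(hQ₁true q hq).1.trans (hQ₁true q hq).2.symm, hQ q (Multiset.mem_of_le hQ₁Q hq)⟩
    · exact Prod.ext_iff.1 (hP q (Multiset.mem_of_le hQ₂P hq))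
  obtain ⟨T, hT, hTcard, hT0⟩ := exists_hasProduct_zero_of_true_pair hσ
    (fun q hq => (hQ₁true q hq).1) hclass (by omega) (by rw [Multiset.card_add]; omega)
  exact ⟨T, hT.trans hle, hTcard, hT0⟩

theorem few_true_arith {k t l : ℕ} (hk : 0 < k) (ht : 3 ≤ t) (hl : 3 ≤ l) (hkt : 5 ≤ k * t) :
    l + k * t + t + 2 * (k * l) ≤ k * t * l + k + 4 := by
  obtain ⟨t, rfl⟩ := Nat.exists_eq_add_of_le ht
  obtain ⟨l, rfl⟩ := Nat.exists_eq_add_of_le hl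
  obtain ⟨k, rfl⟩ := Nat.exists_eq_add_of_le hk
  ring_nf at hkt ⊢
  rcases Nat.eq_zero_or_pos t with rfl | h
  · nlinarith
  · nlinarith [Nat.zero_le (k * l), Nat.zero_le (t * l), Nat.zero_le (k * t),
      Nat.zero_le (k * t * l)]

theorem exists_hasProduct_zero_of_false_mem [Finite M] [Finite L] [IsAddCyclic (M × L)]
    (hσ : ∀ a, F.σ a = (-a.1, a.2)) (hModd : Odd (Nat.card M)) (hM : 5 ≤ Nat.card M)
    (hL : 3 ≤ Nat.card L) {K : AddSubgroup M} (hK : K ≠ ⊤) {S : Multiset (Bool × M × L)}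
    (hSK : ∀ t ∈ S, t.1 = false → t.2.1 ∈ K)
    (hS : 3 * (Nat.card M * Nat.card L) + Nat.card K + 2 ≤
      Multiset.card S + Nat.card L + Nat.card M) :
    ∃ T ≤ S, Multiset.card T = 2 * (Nat.card M * Nat.card L) ∧ F.HasProduct T 0 := by
  let κ (t : Bool × M × L) : Option (M ⧸ K) := if t.1 then some t.2.1 else none
  obtain ⟨Q, hQS, hQ, hQcard⟩ := exists_pairing_card κ S
  have hcoset (q) (hq : q ∈ Q) : q.1.1 = q.2.1 := by
    have h := hQ q hq
    obtain ⟨⟨_ | _, a⟩, _ | _, a'⟩ := q <;> simp_all [κ]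
  have hpair : ∀ q ∈ Q, F.pairProd q ∈ K.prod (⊤ : AddSubgroup L) := by
    intro q hq
    have h := hQ q hq
    have h₁ := hSK q.1 (Multiset.mem_of_le hQS (fst_mem_flatten hq))
    have h₂ := hSK q.2 (Multiset.mem_of_le hQS (snd_mem_flatten hq))
    obtain ⟨⟨_ | _, a⟩, _ | _, a'⟩ := q
    · simpa [AddSubgroup.mem_prod, pairProd] using K.add_mem (h₁ rfl) (h₂ rfl)
    · simp [κ] at h
    · simp [κ] at h
    · simpa [AddSubgroup.mem_prod, pairProd, hσ, κ, QuotientAddGroup.eq] using h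
  have hindex := AddSubgroup.card_mul_index K
  have harith := few_true_arith Nat.card_pos (three_le_index hModd hK) hL (hindex.symm ▸ hM)
  rw [hindex] at harith
  rw [Finite.card_option, ← AddSubgroup.index] at hQcard
  obtain ⟨T, hTQ, hT, hT0⟩ := exists_hasProduct_zero_of_pairs (K.prod ⊤) hcoset hpair
    (k := Nat.card M * Nat.card L)
    (by rw [card_prod_top]; exact Nat.mul_dvd_mul_right (AddSubgroup.card_addSubgroup_dvd_card K) _)
    (by rw [card_prod_top]; omega)
  exact ⟨T, hTQ.trans hQS, hT, hT0⟩

end OddOrder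

end InvolutionFrame

section Blocks

variable {M L : Type*} [AddCommGroup M] [AddCommGroup L]

theorem exists_card_eq_snd_sum_eq_zero [Finite L] [IsAddCyclic L] {U : Multiset (M × L)}
    (hU : 2 * Nat.card L ≤ Multiset.card U + 1) :
    ∃ W ≤ U, Multiset.card W = Nat.card L ∧ W.sum.2 = 0 := by
  simp only [snd_multiset_sum]
  exact exists_sum_map_eq_zero Prod.snd dvd_rfl (by omega)

theorem exists_card_eq_snd_sum_eq_zero_of_mem [Finite L] [IsAddCyclic L] {O U : Multiset (M × L)}
    (hOU : O ≤ U) (hO : Nat.card L ≤ Multiset.card O) (hU : 2 * Nat.card L ≤ Multiset.card U + 1) :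
    ∃ W ≤ U, Multiset.card W = Nat.card L ∧ W.sum.2 = 0 ∧ ∃ a ∈ W, a ∈ O := by
  classical
  obtain ⟨O', hO'O, hO'⟩ := exists_le_card_eq hO
  obtain ⟨R, hR, hRcard⟩ := exists_le_card_eq (S := U - O') (k := Nat.card L - 1) <| by
    rw [Multiset.card_sub (hO'O.trans hOU)]
    omega
  obtain ⟨W, hW, hWcard, hWsum⟩ := exists_card_eq_snd_sum_eq_zero (U := O' + R) <| by
    rw [Multiset.card_add]
    omega
  refine ⟨W, hW.trans (add_le_of_le_tsub (hO'O.trans hOU) hR), hWcard, hWsum, ?_⟩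
  obtain ⟨W₁, hW₁, W₂, hW₂, rfl⟩ := exists_eq_add_of_le_add hW
  have hW₂card := Multiset.card_le_card hW₂
  obtain ⟨a, ha⟩ := Multiset.card_pos_iff_exists_mem.1 (show 0 < Multiset.card W₁ by
    have := Nat.card_pos (α := L)
    rw [Multiset.card_add] at hWcard
    omega)
  exact ⟨a, Multiset.mem_add.2 (.inl ha), Multiset.mem_of_le (hW₁.trans hO'O) ha⟩

/-- A sequence of length `2 * |L|` with terms `y a` for `a` in `A₁` and, at least two, terms
`x * y b` for `b` in the pairs of `Q`, all taken from `A` and `B`, whose sum vanishes in `L`. -/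
structure IsBlock (A B A₁ : Multiset (M × L)) (Q : Multiset ((M × L) × (M × L))) : Prop where
  le_false : A₁ ≤ A
  le_true : flatten Q ≤ B
  ne_zero : Q ≠ 0
  card_add : Multiset.card A₁ + 2 * Multiset.card Q = 2 * Nat.card L
  snd_sum : (A₁.sum + (flatten Q).sum).2 = 0

theorem exists_isBlock_of_many [Finite L] [IsAddCyclic L] {A B : Multiset (M × L)}
    (hA : 2 * Nat.card L ≤ Multiset.card A) (hB : 2 * Nat.card L ≤ Multiset.card B) :
    ∃ A₁ Q, IsBlock A B A₁ Q := by
  have hLpos := Nat.card_pos (α := L)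
  obtain ⟨Q, hQB, hQ⟩ := exists_flatten_le hB
  obtain ⟨P, hPA, hP⟩ := exists_flatten_le (S := A) (k := Nat.card L - 1) (by omega)
  obtain ⟨W, hW, hWcard, hWsum⟩ := exists_sum_map_eq_zero (S := P + Q)
    (fun q => q.1.2 + q.2.2) dvd_rfl (by rw [Multiset.card_add]; omega)
  obtain ⟨P', hP', Q', hQ', rfl⟩ := exists_eq_add_of_le_add hW
  have hP'card := Multiset.card_le_card hP'
  rw [Multiset.card_add] at hWcard
  refine ⟨flatten P', Q', (flatten_mono hP').trans hPA, (flatten_mono hQ').trans hQB, ?_, ?_, ?_⟩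
  · rintro rfl
    rw [Multiset.card_zero] at hWcard
    omega
  · rw [card_flatten]
    omega
  · rw [← hWsum, ← Multiset.sum_add, ← flatten_add, snd_multiset_sum, flatten]
    simp only [Multiset.map_add, Multiset.map_map, Multiset.sum_add, Multiset.sum_map_add,
      Function.comp_apply]
    abel

/-- The sums in `L` of the choices of one component from each pair, up to translation. -/
def choiceSums (Q : Multiset ((M × L) × (M × L))) : Set L :=
  subsetSums (Q.map fun q => q.2.2 - q.1.2)

theorem few_true_pair_arith {k t m : ℕ} (ht : 3 ≤ t) (hm : 5 ≤ m) :
    m * k + 4 * (k * t) ≤ m * (k * t) + 2 * k := by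
  obtain ⟨t, rfl⟩ := Nat.exists_eq_add_of_le ht
  obtain ⟨m, rfl⟩ := Nat.exists_eq_add_of_le hm
  ring_nf
  nlinarith [Nat.zero_le (k * t), Nat.zero_le (k * m), Nat.zero_le (k * t * m)]

theorem exists_ncard_choiceSums_lt_cons [Finite M] [Finite L] [IsAddCyclic (M × L)]
    (hM : 5 ≤ Nat.card M) (hLodd : Odd (Nat.card L)) {A : Multiset (M × L)}
    (hA : 3 * (Nat.card M * Nat.card L) < Multiset.card A + 2 * Nat.card L)
    (hAsum : ¬ ∃ T ≤ A, Multiset.card T = 2 * (Nat.card M * Nat.card L) ∧ T.sum = 0)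
    {Q : Multiset ((M × L) × (M × L))} (hQA : flatten Q ≤ A)
    (hQ : Multiset.card Q < (choiceSums Q).ncard) (hQuniv : choiceSums Q ≠ Set.univ) :
    ∃ p, flatten (p ::ₘ Q) ≤ A ∧ (choiceSums Q).ncard < (choiceSums (p ::ₘ Q)).ncard := by
  classical
  let K := AddAction.stabilizer L (choiceSums Q)
  have hK : K ≠ ⊤ := stabilizer_ne_top (subsetSums_nonempty _) hQuniv
  have hKcard : Nat.card K + (choiceSums Q).ncard ≤ Nat.card L :=
    card_stabilizer_add_ncard_le hQuniv
  have hindex := AddSubgroup.card_mul_index K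
  have harith := few_true_pair_arith (k := Nat.card K) (three_le_index hLodd hK) hM
  rw [hindex] at harith
  have := Nat.mul_le_mul_right (Nat.card L) hM
  have hrest : Multiset.card (A - flatten Q) = Multiset.card A - 2 * Multiset.card Q := by
    rw [Multiset.card_sub hQA, card_flatten]
  obtain ⟨g, hg⟩ := Multiset.card_pos_iff_exists_mem.1
    (show 0 < Multiset.card (A - flatten Q) by omega)
  obtain ⟨R, hR⟩ := Multiset.exists_cons_of_mem hg
  rw [hR, Multiset.card_cons] at hrest
  obtain ⟨h, hhR, hh⟩ : ∃ h ∈ R, h.2 - g.2 ∉ K := by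
    by_contra! hRK
    have hRA : R ≤ A := (Multiset.le_cons_self R g).trans (hR ▸ Multiset.sub_le_self _ _)
    obtain ⟨T, hT, hTcard, hTsum⟩ := exists_sum_eq_zero_of_sub_mem ((⊤ : AddSubgroup M).prod K)
      (S := R) (φ := id) (k := 2 * (Nat.card M * Nat.card L)) g
      (fun h hh => AddSubgroup.mem_prod.2 ⟨AddSubgroup.mem_top _, hRK h hh⟩)
      (by rw [mul_nsmul', ← Nat.card_prod, card_nsmul_eq_zero', nsmul_zero])
      (by rw [card_top_prod]
          exact ((mul_dvd_mul_left _ (AddSubgroup.card_addSubgroup_dvd_card K))).mul_left 2)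
      (by rw [card_top_prod]; omega)
    exact hAsum ⟨T, hT.trans hRA, hTcard, by rwa [Multiset.map_id] at hTsum⟩
  refine ⟨(g, h), ?_, ?_⟩
  · rw [flatten_cons, ← Multiset.singleton_add, ← Multiset.singleton_add, ← add_assoc, add_comm]
    refine add_le_of_le_tsub hQA ?_
    rw [hR, Multiset.singleton_add, Multiset.cons_le_cons_iff]
    exact Multiset.singleton_le.2 hhR
  · rw [choiceSums, choiceSums, Multiset.map_cons]
    exact ncard_subsetSums_lt_cons hh

theorem exists_choiceSums_eq_univ [Finite M] [Finite L] [IsAddCyclic (M × L)]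
    (hM : 5 ≤ Nat.card M) (hLodd : Odd (Nat.card L)) {A : Multiset (M × L)}
    (hA : 3 * (Nat.card M * Nat.card L) < Multiset.card A + 2 * Nat.card L)
    (hAsum : ¬ ∃ T ≤ A, Multiset.card T = 2 * (Nat.card M * Nat.card L) ∧ T.sum = 0) :
    ∃ Q, flatten Q ≤ A ∧ Multiset.card Q < Nat.card L ∧ choiceSums Q = Set.univ := by
  have hgrow (r : ℕ) : ∃ Q, flatten Q ≤ A ∧ Multiset.card Q ≤ r ∧
      min (Nat.card L) (r + 1) ≤ (choiceSums Q).ncard := by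
    induction r with
    | zero =>
      exact ⟨0, Multiset.zero_le _, le_rfl,
        (min_le_right _ _).trans (subsetSums_nonempty _).ncard_pos⟩
    | succ r ih =>
      obtain ⟨Q, hQA, hQr, hQ⟩ := ih
      by_cases hQuniv : choiceSums Q = Set.univ
      · exact ⟨Q, hQA, by omega, by rw [hQuniv, Set.ncard_univ]; exact min_le_left _ _⟩
      · have hlt := card_stabilizer_add_ncard_le hQuniv
        have hpos := Nat.card_pos (α := AddAction.stabilizer L (choiceSums Q))
        obtain ⟨p, hp, hpQ⟩ :=
          exists_ncard_choiceSums_lt_cons hM hLodd hA hAsum hQA (by omega) hQuniv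
        exact ⟨p ::ₘ Q, hp, by rw [Multiset.card_cons]; omega, by omega⟩
  obtain ⟨Q, hQA, hQcard, hQ⟩ := hgrow (Nat.card L - 1)
  have hLpos := Nat.card_pos (α := L)
  have hle := Set.ncard_le_card (choiceSums Q)
  exact ⟨Q, hQA, by omega, (Set.eq_univ_iff_ncard _).2 (by omega)⟩

theorem exists_isBlock_of_few [Finite M] [Finite L] [IsAddCyclic (M × L)]
    (hM : 5 ≤ Nat.card M) (hLodd : Odd (Nat.card L)) {A B : Multiset (M × L)}
    (hA : 3 * (Nat.card M * Nat.card L) < Multiset.card A + 2 * Nat.card L)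
    (hB : 2 ≤ Multiset.card B)
    (hAsum : ¬ ∃ T ≤ A, Multiset.card T = 2 * (Nat.card M * Nat.card L) ∧ T.sum = 0) :
    ∃ A₁ Q, IsBlock A B A₁ Q := by
  classical
  obtain ⟨Q, hQA, hQcard, hQ⟩ := exists_choiceSums_eq_univ hM hLodd hA hAsum
  obtain ⟨P, hPB, hP⟩ := exists_flatten_le (k := 1) hB
  obtain ⟨E, hE, hEcard⟩ := exists_le_card_eq (S := A - flatten Q)
    (k := 2 * Nat.card L - 2 - Multiset.card Q) <| by
      rw [Multiset.card_sub hQA, card_flatten]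
      have hML := Nat.mul_le_mul_right (Nat.card L) hM
      omega
  obtain ⟨T, hT, hTcard, hTsum⟩ := exists_choice_of_mem_subsetSums (φ := Prod.snd) (Q := Q)
    (show -((Q.map fun q => q.1.2).sum + E.sum.2 + (flatten P).sum.2) ∈ choiceSums Q from
      hQ ▸ Set.mem_univ _)
  refine ⟨T + E, P, (add_le_add_left hT E).trans (add_le_of_le_tsub hQA hE), hPB, ?_, ?_, ?_⟩
  · rintro rfl
    simp at hP
  · rw [Multiset.card_add]
    omega
  · rw [Multiset.sum_add, Prod.snd_add, Prod.snd_add, snd_multiset_sum T, hTsum]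
    abel

end Blocks

namespace InvolutionFrame

variable {G M L : Type*} [Group G] [AddCommGroup M]

/-- The elements of `M` by which the product of a sequence changes when some of its terms `y a`
with `a` in `A` are moved in between two terms outside of `y (M × L)`. -/
def flipSums (A : Multiset (M × L)) : Set M := subsetSums (A.map fun a => -(a.1 + a.1))

theorem flipSums_mono {A A' : Multiset (M × L)} (h : A ≤ A') : flipSums A ⊆ flipSums A' :=
  subsetSums_mono (Multiset.map_le_map h)

variable [AddCommGroup L] {F : InvolutionFrame G (M × L)}

theorem exists_hasProduct_map_true_flatten (hσ : ∀ a, F.σ a = (-a.1, a.2))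
    (Q : Multiset ((M × L) × (M × L))) :
    ∃ c, F.HasProduct ((flatten Q).map (Prod.mk true)) c ∧ c.2 = (flatten Q).sum.2 := by
  induction Q using Multiset.induction with
  | empty => exact ⟨0, hasProduct_zero, rfl⟩
  | cons q Q ih =>
    obtain ⟨c, hc, hcQ⟩ := ih
    refine ⟨F.σ q.1 + q.2 + c, ?_, by simp [flatten_cons, hσ, hcQ, add_assoc]⟩
    rw [flatten_cons, Multiset.map_cons, Multiset.map_cons, ← Multiset.singleton_add,
      ← Multiset.singleton_add, ← add_assoc]
    exact (hasProduct_pair_true q.1 q.2).add hc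

theorem exists_hasProduct_terms_of_mem_flipSums (hσ : ∀ a, F.σ a = (-a.1, a.2))
    {A : Multiset (M × L)} {u : M} (hu : u ∈ flipSums A) {U : Multiset (Bool × M × L)}
    {c b b' : M × L} (hU : F.HasProduct U c) :
    F.HasProduct ((true, b) ::ₘ (true, b') ::ₘ (A.map (Prod.mk false) + U))
      (F.σ b + b' + A.sum + c + (u, 0)) := by
  obtain ⟨D, hDA, rfl⟩ := exists_le_map_iff.1 hu
  obtain ⟨E, rfl⟩ := Multiset.le_iff_exists_add.1 hDA
  have hflip : F.σ D.sum = D.sum + ((D.map fun a => -(a.1 + a.1)).sum, 0) := by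
    have hfst : D.sum.1 = (D.map Prod.fst).sum := map_multiset_sum (AddMonoidHom.fst M L) D
    rw [hσ]
    ext
    · simp [hfst, Multiset.sum_map_add]
    · simp
  have h := HasProduct.flip b b' (hasProduct_map_false (F := F) D)
    ((hasProduct_map_false (F := F) E).add hU)
  rw [hflip] at h
  convert h using 1
  · rw [Multiset.map_add, Multiset.insert_eq_cons, Multiset.cons_add, Multiset.singleton_add,
      add_assoc]
  · rw [Multiset.sum_add]
    abel

theorem hasProduct_terms_zero (hσ : ∀ a, F.σ a = (-a.1, a.2)) {A : Multiset (M × L)}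
    {Q : Multiset ((M × L) × (M × L))} (hQ : Q ≠ 0) (hsum : (A.sum + (flatten Q).sum).2 = 0)
    (hA : flipSums A = Set.univ) : F.HasProduct (terms A (flatten Q)) 0 := by
  obtain ⟨q, hq⟩ := Multiset.exists_mem_of_ne_zero hQ
  obtain ⟨Q, rfl⟩ := Multiset.exists_cons_of_mem hq
  obtain ⟨c, hc, hcQ⟩ := exists_hasProduct_map_true_flatten hσ Q
  have h := exists_hasProduct_terms_of_mem_flipSums hσ (b := q.1) (b' := q.2)
    (u := -(F.σ q.1 + q.2 + A.sum + c).1) (hA ▸ Set.mem_univ _) hc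
  convert h using 1
  · simp only [terms, flatten_cons, Multiset.map_cons, Multiset.add_cons]
  · rw [flatten_cons] at hsum
    ext
    · simp
    · simp only [Multiset.sum_cons, Prod.snd_add] at hsum
      simp only [hσ, Prod.snd_add, hcQ, Prod.snd_zero, add_zero]
      refine hsum.symm.trans ?_
      abel

variable [Finite M] [Finite L] [IsAddCyclic (M × L)]

open Classical in
theorem le_card_filter_notMem_stabilizer_flipSums (hσ : ∀ a, F.σ a = (-a.1, a.2))
    (hModd : Odd (Nat.card M)) (hM : 5 ≤ Nat.card M) (hL : 3 ≤ Nat.card L)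
    {A B A₂ : Multiset (M × L)}
    (hAB : Multiset.card (terms A B) = 3 * (Nat.card M * Nat.card L))
    (hno : ¬ ∃ T ≤ terms A B, Multiset.card T = 2 * (Nat.card M * Nat.card L) ∧ F.HasProduct T 0)
    (hA₂ : A₂ ≤ A) (hA₂univ : flipSums A₂ ≠ Set.univ) :
    Nat.card L ≤ Multiset.card
      ((A - A₂).filter fun a => a.1 ∉ AddAction.stabilizer M (flipSums A₂)) := by
  let K := AddAction.stabilizer M (flipSums A₂)
  have hKtop : K ≠ ⊤ := stabilizer_ne_top (subsetSums_nonempty _) hA₂univ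
  have hKcard : Nat.card K + (flipSums A₂).ncard ≤ Nat.card M :=
    card_stabilizer_add_ncard_le hA₂univ
  have hA₂out : Multiset.card (A₂.filter fun a => a.1 ∉ K) < (flipSums A₂).ncard := by
    refine lt_of_le_of_lt ?_ (card_filter_notMem_lt_ncard_subsetSums K _ le_rfl)
    rw [Multiset.filter_map, Multiset.card_map]
    exact Multiset.card_le_card (Multiset.monotone_filter_right _ fun a ha hKa =>
      ha (mem_of_neg_add_self_mem hModd K hKa))
  have hAout : Multiset.card (A.filter fun a => a.1 ∉ K) =
      Multiset.card (A₂.filter fun a => a.1 ∉ K) +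
        Multiset.card ((A - A₂).filter fun a => a.1 ∉ K) := by
    rw [← Multiset.card_add, ← Multiset.filter_add, add_tsub_cancel_of_le hA₂]
  have hAcard := congrArg Multiset.card (Multiset.filter_add_not (fun a => a.1 ∈ K) A)
  rw [Multiset.card_add] at hAcard
  rw [card_terms] at hAB
  by_contra! hlt : Multiset.card ((A - A₂).filter fun a => a.1 ∉ K) < Nat.card L
  have hle : terms (A.filter fun a => a.1 ∈ K) B ≤ terms A B :=
    terms_mono (Multiset.filter_le _ _) le_rfl
  obtain ⟨T, hT, hT'⟩ := exists_hasProduct_zero_of_false_mem hσ hModd hM hL hKtop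
    (S := terms (A.filter fun a => a.1 ∈ K) B)
    (by simp only [terms, Multiset.mem_add, Multiset.mem_map, Multiset.mem_filter]; grind)
    (by rw [card_terms]; omega)
  exact hno ⟨T, hT.trans hle, hT'⟩

theorem extension_arith {m l r : ℕ} (hm : 5 ≤ m) (hl : 3 ≤ l) (hr : r + 3 ≤ 2 * m) :
    r * l + 3 * l + (m + 3 * l) ≤ 3 * (m * l) + 3 := by
  nlinarith [Nat.mul_le_mul_right l hr, Nat.mul_le_mul hm hl]

theorem exists_flipSums_add_ge (hσ : ∀ a, F.σ a = (-a.1, a.2)) (hModd : Odd (Nat.card M))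
    (hM : 5 ≤ Nat.card M) (hL : 3 ≤ Nat.card L) {A B A₂ : Multiset (M × L)}
    (hAB : Multiset.card (terms A B) = 3 * (Nat.card M * Nat.card L))
    (hno : ¬ ∃ T ≤ terms A B, Multiset.card T = 2 * (Nat.card M * Nat.card L) ∧ F.HasProduct T 0)
    (hA₂ : A₂ ≤ A) (hcard : Multiset.card A₂ + 2 * Nat.card L ≤ Multiset.card A + 1) :
    ∃ W, A₂ + W ≤ A ∧ Multiset.card W = Nat.card L ∧ W.sum.2 = 0 ∧
      min (Nat.card M) ((flipSums A₂).ncard + 1) ≤ (flipSums (A₂ + W)).ncard := by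
  classical
  have : IsAddCyclic L := isAddCyclic_of_surjective (AddMonoidHom.snd M L) Prod.snd_surjective
  have hrest : 2 * Nat.card L ≤ Multiset.card (A - A₂) + 1 := by
    rw [Multiset.card_sub hA₂]
    omega
  by_cases hA₂univ : flipSums A₂ = Set.univ
  · obtain ⟨W, hW, hWcard, hWsum⟩ := exists_card_eq_snd_sum_eq_zero hrest
    refine ⟨W, add_le_of_le_tsub hA₂ hW, hWcard, hWsum, (min_le_left _ _).trans ?_⟩
    rw [← Set.ncard_univ, ← hA₂univ]
    exact Set.ncard_le_ncard (flipSums_mono (Multiset.le_add_right _ _))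
  · obtain ⟨W, hW, hWcard, hWsum, a, haW, ha⟩ := exists_card_eq_snd_sum_eq_zero_of_mem
      (Multiset.filter_le _ _) (le_card_filter_notMem_stabilizer_flipSums hσ hModd hM hL hAB hno
        hA₂ hA₂univ) hrest
    refine ⟨W, add_le_of_le_tsub hA₂ hW, hWcard, hWsum, ?_⟩
    have hgrow : (flipSums A₂).ncard < (flipSums (a ::ₘ A₂)).ncard := by
      rw [flipSums, flipSums, Multiset.map_cons]
      exact ncard_subsetSums_lt_cons fun h =>
        (Multiset.mem_filter.1 ha).2 (mem_of_neg_add_self_mem hModd _ h)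
    have hle : a ::ₘ A₂ ≤ A₂ + W := by
      rw [← Multiset.singleton_add, add_comm]
      exact add_le_add_right (Multiset.singleton_le.2 haW) A₂
    have hmono := Set.ncard_le_ncard (flipSums_mono hle)
    omega

theorem exists_flipSums_ge (hσ : ∀ a, F.σ a = (-a.1, a.2)) (hModd : Odd (Nat.card M))
    (hM : 5 ≤ Nat.card M) (hL : 3 ≤ Nat.card L) {A B A₁ : Multiset (M × L)}
    (hAB : Multiset.card (terms A B) = 3 * (Nat.card M * Nat.card L))
    (hno : ¬ ∃ T ≤ terms A B, Multiset.card T = 2 * (Nat.card M * Nat.card L) ∧ F.HasProduct T 0)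
    (hB : Multiset.card B + 2 ≤ Nat.card M + 2 * Nat.card L)
    (hA₁ : A₁ ≤ A) (hA₁card : Multiset.card A₁ ≤ 2 * Nat.card L) {r : ℕ}
    (hr : r + 2 ≤ 2 * Nat.card M) :
    ∃ A₂ ≤ A, Multiset.card A₂ = Multiset.card A₁ + r * Nat.card L ∧ A₂.sum.2 = A₁.sum.2 ∧
      min (Nat.card M) (r + 1) ≤ (flipSums A₂).ncard := by
  induction r with
  | zero =>
    exact ⟨A₁, hA₁, by simp, rfl, (min_le_right _ _).trans (subsetSums_nonempty _).ncard_pos⟩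
  | succ r ih =>
    obtain ⟨A₂, hA₂, hA₂card, hA₂sum, hA₂flip⟩ := ih (by omega)
    have harith := extension_arith hM hL (show r + 3 ≤ 2 * Nat.card M by omega)
    have hABcard := hAB
    rw [card_terms] at hABcard
    obtain ⟨W, hW, hWcard, hWsum, hWflip⟩ :=
      exists_flipSums_add_ge hσ hModd hM hL hAB hno hA₂ (by omega)
    refine ⟨A₂ + W, hW, ?_, ?_, by omega⟩
    · rw [Multiset.card_add, hA₂card, hWcard]
      ring
    · rw [Multiset.sum_add, Prod.snd_add, hWsum, hA₂sum, add_zero]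

theorem exists_hasProduct_two_mul (hσ : ∀ a, F.σ a = (-a.1, a.2))
    (hModd : Odd (Nat.card M)) (hM : 5 ≤ Nat.card M) (hLodd : Odd (Nat.card L))
    (hL : 3 ≤ Nat.card L) {S : Multiset (Bool × M × L)}
    (hS : Multiset.card S = 3 * (Nat.card M * Nat.card L)) :
    ∃ T ≤ S, Multiset.card T = 2 * (Nat.card M * Nat.card L) ∧ F.HasProduct T 0 := by
  have : IsAddCyclic L := isAddCyclic_of_surjective (AddMonoidHom.snd M L) Prod.snd_surjective
  obtain ⟨A, B, rfl⟩ := exists_eq_terms S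
  have hAB := hS
  rw [card_terms] at hAB
  have hML := Nat.mul_le_mul_right (Nat.card L) hM
  have hML' := Nat.mul_le_mul_left (Nat.card M) hL
  by_contra hno
  have hA : ¬ ∃ T ≤ A, Multiset.card T = 2 * (Nat.card M * Nat.card L) ∧ T.sum = 0 := by
    rintro ⟨T, hTA, hT, hTsum⟩
    exact hno ⟨T.map (Prod.mk false), (Multiset.map_le_map hTA).trans (Multiset.le_add_right _ _),
      by rw [Multiset.card_map, hT], hTsum ▸ hasProduct_map_false T⟩
  have hB : Multiset.card B + 2 ≤ Nat.card M + 2 * Nat.card L := by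
    by_contra! hB
    exact hno (exists_hasProduct_zero_of_many_true hσ (by omega) hL hS (U := B.map (Prod.mk true))
      (Multiset.le_add_left _ _) (by simp) (by rw [Multiset.card_map]; omega))
  have hB2 : 2 ≤ Multiset.card B := by
    by_contra! hB2
    rw [← Nat.card_prod] at hA hAB
    exact hA (by simpa only [Multiset.map_id] using
      exists_sum_map_eq_zero id (dvd_mul_left (Nat.card (M × L)) 2) (by omega))
  obtain ⟨A₁, Q, hblock⟩ : ∃ A₁ Q, IsBlock A B A₁ Q := by
    by_cases hBL : Multiset.card B < 2 * Nat.card L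
    · exact exists_isBlock_of_few hM hLodd (by omega) hB2 hA
    · exact exists_isBlock_of_many (by omega) (by omega)
  have hblockcard := hblock.card_add
  obtain ⟨A₂, hA₂, hA₂card, hA₂sum, hA₂flip⟩ := exists_flipSums_ge hσ hModd hM hL hS hno hB
    hblock.le_false (by omega) (show 2 * Nat.card M - 2 + 2 ≤ 2 * Nat.card M by omega)
  refine hno ⟨terms A₂ (flatten Q), terms_mono hA₂ hblock.le_true, ?_, ?_⟩
  · rw [card_terms, card_flatten, hA₂card, add_right_comm, hblockcard, ← add_mul,
      show 2 + (2 * Nat.card M - 2) = 2 * Nat.card M by omega, mul_assoc]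
  · refine hasProduct_terms_zero hσ hblock.ne_zero ?_ ((Set.eq_univ_iff_ncard _).2 ?_)
    · rw [Prod.snd_add, hA₂sum, ← Prod.snd_add, hblock.snd_sum]
    · have := Set.ncard_le_card (flipSums A₂)
      omega

end InvolutionFrame

theorem sInf_card_threshold_eq {α : Type*} {P : Multiset α → Prop} {L : ℕ}
    (hP : ∀ S, L + 1 ≤ Multiset.card S → P S) {W : Multiset α} (hW : Multiset.card W = L)
    (hPW : ¬ P W) : sInf {l | 0 < l ∧ ∀ S, l ≤ Multiset.card S → P S} = L + 1 := by
  have hmem : L + 1 ∈ {l | 0 < l ∧ ∀ S, l ≤ Multiset.card S → P S} := ⟨Nat.succ_pos _, hP⟩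
  refine le_antisymm (Nat.sInf_le hmem) (le_csInf ⟨_, hmem⟩ ?_)
  rintro l ⟨-, hl⟩
  by_contra! h
  exact hPW (hl W (by omega))

section Constants

variable {G : Type*} [Group G]

theorem IsProductOne.of_cons_one {T : Multiset G} (h : IsProductOne (1 ::ₘ T)) :
    IsProductOne T := by
  obtain ⟨l, hl, hprod⟩ := h
  have hmem : (1 : G) ∈ l := by
    rw [← Multiset.mem_coe, hl]
    exact Multiset.mem_cons_self _ _
  obtain ⟨u, v, rfl⟩ := List.mem_iff_append.1 hmem
  refine ⟨u ++ v, ?_, by simpa using hprod⟩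
  rw [← Multiset.coe_add, ← Multiset.cons_coe, Multiset.add_cons] at hl
  rw [← Multiset.coe_add]
  exact (Multiset.cons_inj_right _).1 hl

theorem IsProductOne.of_add_replicate_one {T : Multiset G} {j : ℕ}
    (h : IsProductOne (T + Multiset.replicate j 1)) : IsProductOne T := by
  induction j with
  | zero => simpa using h
  | succ j ih =>
    rw [Multiset.replicate_succ, Multiset.add_cons] at h
    exact ih h.of_cons_one

theorem IsProductOne.add {T U : Multiset G} (hT : IsProductOne T) (hU : IsProductOne U) :
    IsProductOne (T + U) := by
  rw [IsProductOne, ← one_mul (1 : G)]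
  exact mul_mem_products hT hU

theorem IsProductOne.prod_map_eq_one {H : Type*} [CommGroup H] {T : Multiset G}
    (h : IsProductOne T) (φ : G →* H) : (T.map φ).prod = 1 := by
  obtain ⟨l, rfl, hl⟩ := h
  rw [Multiset.map_coe, Multiset.prod_coe, ← map_list_prod, hl, map_one]

theorem isProductOneFree_replicate {g : G} {k : ℕ} (hk : k < orderOf g) :
    IsProductOneFree (Multiset.replicate k g) := by
  rintro T hT hTcard ⟨l, hl, hprod⟩
  obtain ⟨j, hj, rfl⟩ := Multiset.le_replicate_iff.1 hT
  rw [← Multiset.coe_replicate, Multiset.coe_eq_coe, List.perm_replicate] at hl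
  rw [hl, List.prod_replicate] at hprod
  rw [Multiset.card_replicate] at hTcard
  exact pow_ne_one_of_lt_orderOf (by omega) (by omega) hprod

theorem IsProductOneFree.cons {H : Type*} [CommGroup H] {W : Multiset G}
    (hW : IsProductOneFree W) (φ : G →* H) (hφ : ∀ w ∈ W, φ w = 1) {g : G} (hg : φ g ≠ 1) :
    IsProductOneFree (g ::ₘ W) := by
  intro T hT hTcard hT1
  rcases le_cons_iff.1 hT with hT | ⟨T, hTW, rfl⟩
  · exact hW T hT hTcard hT1
  · have hTφ : (T.map φ).prod = 1 := Multiset.prod_eq_one fun h hh => by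
      obtain ⟨w, hw, rfl⟩ := Multiset.mem_map.1 hh
      exact hφ w (Multiset.mem_of_le hTW hw)
    have hprod := hT1.prod_map_eq_one φ
    rw [Multiset.map_cons, Multiset.prod_cons, hTφ, mul_one] at hprod
    exact hg hprod

theorem hasProductOneSub_two_mul {k L : ℕ}
    (h : ∀ S : Multiset G, L ≤ Multiset.card S → HasProductOneSub k S) {S : Multiset G}
    (hS : L + k ≤ Multiset.card S) : HasProductOneSub (2 * k) S := by
  classical
  obtain ⟨T, hT, hTcard, hT1⟩ := h S (by omega)
  obtain ⟨U, hU, hUcard, hU1⟩ := h (S - T) (by rw [Multiset.card_sub hT]; omega)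
  exact ⟨T + U, add_le_of_le_tsub hT hU, by rw [Multiset.card_add]; omega, hT1.add hU1⟩

theorem exists_isProductOne_of_add_replicate_one {S : Multiset G} {k : ℕ} (hk : 0 < k)
    (h : HasProductOneSub k (S + Multiset.replicate (k - 1) 1)) :
    ∃ T ≤ S, 1 ≤ Multiset.card T ∧ Multiset.card T ≤ k ∧ IsProductOne T := by
  obtain ⟨T, hT, hTcard, hT1⟩ := h
  obtain ⟨T₁, hT₁, T₂, hT₂, rfl⟩ := exists_eq_add_of_le_add hT
  obtain ⟨j, hj, rfl⟩ := Multiset.le_replicate_iff.1 hT₂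
  rw [Multiset.card_add, Multiset.card_replicate] at hTcard
  exact ⟨T₁, hT₁, by omega, by omega, hT1.of_add_replicate_one⟩

namespace IsProductOneFree

variable {W : Multiset G} {k : ℕ}

theorem sInf_hasProductOneSub_eq (hW : IsProductOneFree W) (hk : 0 < k)
    (h : ∀ S : Multiset G, Multiset.card W + k ≤ Multiset.card S → HasProductOneSub k S) :
    sInf {l | 0 < l ∧ ∀ S : Multiset G, l ≤ Multiset.card S → HasProductOneSub k S} =
      Multiset.card W + k := by
  have hnot : ¬ HasProductOneSub k (W + Multiset.replicate (k - 1) 1) := fun hsub => by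
    obtain ⟨T, hT, hTcard, -, hT1⟩ := exists_isProductOne_of_add_replicate_one hk hsub
    exact hW T hT hTcard hT1
  rw [sInf_card_threshold_eq (L := Multiset.card W + (k - 1)) (fun S hS => h S (by omega))
    (by simp) hnot]
  omega

theorem constants_eq [Finite G] (hW : IsProductOneFree W)
    (hgao : ∀ S : Multiset G, Multiset.card W + Nat.card G ≤ Multiset.card S →
      HasProductOneSub (Nat.card G) S)
    (hegz : ∀ S : Multiset G, Multiset.card W + Monoid.exponent G ≤ Multiset.card S →
      HasProductOneSub (Monoid.exponent G) S) :
    gaoConstant G = Multiset.card W + Nat.card G ∧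
      egzConstant G = Multiset.card W + Monoid.exponent G ∧
      etaConstant G = Multiset.card W + 1 ∧ smallDavenport G = Multiset.card W := by
  have hexp : 0 < Monoid.exponent G := Nat.pos_of_ne_zero Monoid.exponent_ne_zero_of_finite
  have hshort (S : Multiset G) (hS : Multiset.card W + 1 ≤ Multiset.card S) :
      HasShortProductOneSub S :=
    exists_isProductOne_of_add_replicate_one hexp
      (hegz _ (by rw [Multiset.card_add, Multiset.card_replicate]; omega))
  refine ⟨hW.sInf_hasProductOneSub_eq Nat.card_pos hgao, hW.sInf_hasProductOneSub_eq hexp hegz,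
    sInf_card_threshold_eq hshort rfl ?_, IsGreatest.csSup_eq ⟨⟨W, rfl, hW⟩, ?_⟩⟩
  · rintro ⟨T, hT, hTcard, -, hT1⟩
    exact hW T hT hTcard hT1
  · rintro k ⟨S, rfl, hS⟩
    by_contra! hlt
    obtain ⟨T, hT, hTcard, -, hT1⟩ := hshort S hlt
    exact hS T hT hTcard hT1

end IsProductOneFree

end Constants

namespace InvolutionFrame

variable {G N : Type*} [Group G] [AddCommGroup N] (F : InvolutionFrame G N)

theorem y_neg (a : N) : F.y (-a) = (F.y a)⁻¹ :=
  eq_inv_of_mul_eq_one_left (by rw [← F.y_add, neg_add_cancel, F.y_zero])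

theorem y_nsmul (k : ℕ) (a : N) : F.y (k • a) = F.y a ^ k := by
  induction k with
  | zero => rw [zero_nsmul, F.y_zero, pow_zero]
  | succ k ih => rw [succ_nsmul, F.y_add, ih, pow_succ]

theorem eval_true_sq (a : N) : F.eval (true, a) ^ 2 = F.y (F.σ a + a) := by
  rw [eval_true, sq, mul_assoc, ← mul_assoc (F.y a), F.y_mul_x, ← mul_assoc, ← mul_assoc,
    F.x_mul_x, one_mul, ← F.y_add]

theorem exists_eval_eq_x_mul (t : Bool × N) : ∃ u, F.eval u = F.x * F.eval t := by
  obtain ⟨_ | _, a⟩ := t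
  · exact ⟨(true, a), rfl⟩
  · exact ⟨(false, a), by rw [eval_true, ← mul_assoc, F.x_mul_x, one_mul, eval_false]⟩

theorem exists_eval_eq_y_mul (a : N) (t : Bool × N) : ∃ u, F.eval u = F.y a * F.eval t := by
  obtain ⟨_ | _, b⟩ := t
  · exact ⟨(false, a + b), F.y_add a b⟩
  · exact ⟨(true, F.σ a + b),
      by rw [eval_true, eval_true, F.y_add, ← mul_assoc, ← mul_assoc, F.y_mul_x]⟩

theorem eval_surjective (h : Subgroup.closure (insert F.x (Set.range F.y)) = ⊤) :
    Function.Surjective F.eval := by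
  intro g
  have hg : g ∈ Subgroup.closure (insert F.x (Set.range F.y)) := h ▸ Subgroup.mem_top g
  induction hg using Subgroup.closure_induction_left with
  | one => exact ⟨(false, 0), F.y_zero⟩
  | mul_left g hg _ _ ih =>
    obtain ⟨t, rfl⟩ := ih
    obtain rfl | ⟨a, rfl⟩ := hg
    · exact F.exists_eval_eq_x_mul t
    · exact F.exists_eval_eq_y_mul a t
  | inv_mul_cancel g hg _ _ ih =>
    obtain ⟨t, rfl⟩ := ih
    obtain rfl | ⟨a, rfl⟩ := hg
    · rw [inv_eq_of_mul_eq_one_left F.x_mul_x]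
      exact F.exists_eval_eq_x_mul t
    · rw [← F.y_neg]
      exact F.exists_eval_eq_y_mul (-a) t

theorem eval_injective (hy : Function.Injective F.y) (hx : F.x ∉ Set.range F.y) :
    Function.Injective F.eval := by
  have hne (a b : N) : F.x * F.y a ≠ F.y b := fun h =>
    hx ⟨b - a, by rw [sub_eq_add_neg, F.y_add, F.y_neg, ← h, mul_inv_cancel_right]⟩
  rintro ⟨_ | _, a⟩ ⟨_ | _, b⟩ h
  · exact congrArg _ (hy h)
  · exact absurd h.symm (hne b a)
  · exact absurd h (hne a b)
  · exact congrArg _ (hy (mul_left_cancel h))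

end InvolutionFrame

namespace Gns

variable {n : ℕ} {s : ℤ}

/-- The generator `x`. -/
def x (n : ℕ) (s : ℤ) : Gns n s := PresentedGroup.of Gen.x

/-- The generator `y`. -/
def y (n : ℕ) (s : ℤ) : Gns n s := PresentedGroup.of Gen.y

theorem x_sq : x n s ^ 2 = 1 :=
  PresentedGroup.one_of_mem (x := FreeGroup.of Gen.x ^ 2) (by simp [rels])

theorem y_pow : y n s ^ n = 1 :=
  PresentedGroup.one_of_mem (x := FreeGroup.of Gen.y ^ n) (by simp [rels])

theorem y_mul_x : y n s * x n s = x n s * y n s ^ s := by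
  have h := PresentedGroup.one_of_mem (rels := rels n s)
    (x := FreeGroup.of Gen.y * FreeGroup.of Gen.x *
      (FreeGroup.of Gen.x * FreeGroup.of Gen.y ^ s)⁻¹) (by simp [rels])
  rwa [map_mul, map_inv, mul_inv_eq_one, map_mul, map_mul, map_zpow] at h

theorem y_zpow_mul_x (k : ℤ) : y n s ^ k * x n s = x n s * y n s ^ (s * k) := by
  have h : x n s * y n s ^ s * (x n s)⁻¹ = y n s := by rw [← y_mul_x, mul_inv_cancel_right]
  conv_lhs => rw [← h]
  rw [zpow_mul, conj_zpow, inv_mul_cancel_right]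

/-- The homomorphism from `Gns n s` to `H` that takes `x` to `a` and `y` to `b`. -/
def lift {H : Type*} [Group H] (a b : H) (ha : a ^ 2 = 1) (hb : b ^ n = 1)
    (hba : b * a = a * b ^ s) : Gns n s →* H :=
  PresentedGroup.toGroup (f := fun i => match i with | Gen.x => a | Gen.y => b) (by
    rintro r (rfl | rfl | rfl)
    · simpa using ha
    · simpa using hb
    · simpa only [map_mul, map_inv, map_zpow, FreeGroup.lift_apply_of, mul_inv_eq_one] using hba)

theorem lift_x {H : Type*} [Group H] {a b : H} (ha : a ^ 2 = 1) (hb : b ^ n = 1)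
    (hba : b * a = a * b ^ s) : lift a b ha hb hba (x n s) = a := PresentedGroup.toGroup.of _

theorem lift_y {H : Type*} [Group H] {a b : H} (ha : a ^ 2 = 1) (hb : b ^ n = 1)
    (hba : b * a = a * b ^ s) : lift a b ha hb hba (y n s) = b := PresentedGroup.toGroup.of _

/-- The homomorphism to `C₂` with kernel generated by `y`. -/
def sign (n : ℕ) (s : ℤ) : Gns n s →* Multiplicative (ZMod 2) :=
  lift (Multiplicative.ofAdd 1) 1 (by decide) (one_pow n) (by rw [one_zpow, one_mul, mul_one])

theorem sign_x_ne_one : sign n s (x n s) ≠ 1 := by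
  rw [sign, lift_x]
  decide

theorem sign_y : sign n s (y n s) = 1 := lift_y _ _ _

theorem intCast_mul_self (hs : s ^ 2 ≡ 1 [ZMOD n]) : (s : ZMod n) * s = 1 := by
  rw [← sq]
  exact_mod_cast (ZMod.intCast_eq_intCast_iff _ _ _).2 hs

/-- The action of `Gns n s` on `ZMod n` for which `y` is translation by `1` and `x` is
multiplication by `s`. -/
def perm (hs : s ^ 2 ≡ 1 [ZMOD n]) : Gns n s →* Equiv.Perm (ZMod n) :=
  have hinv : Function.Involutive fun a : ZMod n => s * a :=
    fun a => by simp only [← mul_assoc, intCast_mul_self hs, one_mul]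
  lift hinv.toPerm (Equiv.addLeft 1)
    (by ext a; simpa [sq] using hinv a)
    (by ext a; simp)
    (by ext a; simp [mul_add, intCast_mul_self hs])

theorem perm_y (hs : s ^ 2 ≡ 1 [ZMOD n]) : perm hs (y n s) = Equiv.addLeft 1 := by
  rw [perm, lift_y]

theorem perm_y_zpow_apply_zero (hs : s ^ 2 ≡ 1 [ZMOD n]) (k : ℤ) :
    perm hs (y n s ^ k) 0 = k := by
  simp [perm_y]

/-- The homomorphism `a ↦ y ^ a` from `ZMod n`, written additively. -/
def yHom (n : ℕ) (s : ℤ) : ZMod n →+ Additive (Gns n s) :=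
  ZMod.lift n ⟨zmultiplesHom _ (Additive.ofMul (y n s)), by
    rw [zmultiplesHom_apply, natCast_zsmul, ← ofMul_pow, y_pow, ofMul_one]⟩

theorem yHom_intCast (k : ℤ) : (yHom n s k).toMul = y n s ^ k := by
  rw [yHom, ZMod.lift_coe]
  rfl

/-- The normal form `x ^ e * y ^ a` of the elements of `Gns n s`. -/
def frame (hs : s ^ 2 ≡ 1 [ZMOD n]) : InvolutionFrame (Gns n s) (ZMod n) where
  y a := (yHom n s a).toMul
  x := x n s
  σ := AddMonoidHom.mulLeft (s : ZMod n)
  y_add a b := by rw [map_add, toMul_add]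
  x_mul_x := by rw [← sq, x_sq]
  y_mul_x a := by
    obtain ⟨k, rfl⟩ := ZMod.intCast_surjective a
    rw [AddMonoidHom.coe_mulLeft, ← Int.cast_mul, yHom_intCast, yHom_intCast, y_zpow_mul_x]
  σ_σ a := by
    rw [AddMonoidHom.coe_mulLeft, ← mul_assoc, intCast_mul_self hs, one_mul]

theorem frame_σ (hs : s ^ 2 ≡ 1 [ZMOD n]) (a : ZMod n) : (frame hs).σ a = s * a := rfl

theorem frame_y_intCast (hs : s ^ 2 ≡ 1 [ZMOD n]) (k : ℤ) : (frame hs).y k = y n s ^ k :=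
  yHom_intCast k

theorem frame_eval_surjective (hs : s ^ 2 ≡ 1 [ZMOD n]) :
    Function.Surjective (frame hs).eval := by
  refine (frame hs).eval_surjective (top_le_iff.1 ?_)
  rw [← PresentedGroup.closure_range_of]
  refine Subgroup.closure_mono ?_
  rintro _ ⟨_ | _, rfl⟩
  · exact Set.mem_insert _ _
  · exact Set.mem_insert_of_mem _ ⟨(1 : ℤ), by rw [frame_y_intCast, zpow_one, y]⟩

theorem frame_y_injective (hs : s ^ 2 ≡ 1 [ZMOD n]) : Function.Injective (frame hs).y := by
  intro a b h
  obtain ⟨k, rfl⟩ := ZMod.intCast_surjective a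
  obtain ⟨l, rfl⟩ := ZMod.intCast_surjective b
  rw [frame_y_intCast, frame_y_intCast] at h
  rw [← perm_y_zpow_apply_zero hs, h, perm_y_zpow_apply_zero hs]

theorem frame_eval_injective (hs : s ^ 2 ≡ 1 [ZMOD n]) : Function.Injective (frame hs).eval := by
  refine (frame hs).eval_injective (frame_y_injective hs) ?_
  rintro ⟨a, ha⟩
  obtain ⟨k, rfl⟩ := ZMod.intCast_surjective a
  rw [frame_y_intCast] at ha
  refine sign_x_ne_one (n := n) (s := s) ?_
  rw [show x n s = y n s ^ k from ha.symm, map_zpow, sign_y, one_zpow]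

theorem card_eq (hs : s ^ 2 ≡ 1 [ZMOD n]) : Nat.card (Gns n s) = 2 * n := by
  rw [← Nat.card_eq_of_bijective _ ⟨frame_eval_injective hs, frame_eval_surjective hs⟩,
    Nat.card_prod, Nat.card_zmod, Nat.card_eq_fintype_card, Fintype.card_bool]

theorem orderOf_y (hs : s ^ 2 ≡ 1 [ZMOD n]) : orderOf (y n s) = n := by
  refine Nat.dvd_antisymm (orderOf_dvd_of_pow_eq_one y_pow) ((ZMod.natCast_eq_zero_iff _ _).1 ?_)
  rw [← Int.cast_natCast, ← perm_y_zpow_apply_zero hs, zpow_natCast, pow_orderOf_eq_one, map_one,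
    Equiv.Perm.one_apply]

theorem orderOf_x : orderOf (x n s) = 2 :=
  orderOf_eq_prime x_sq fun h => sign_x_ne_one (by rw [h, map_one])

theorem dvd_exponent (hs : s ^ 2 ≡ 1 [ZMOD n]) : n ∣ Monoid.exponent (Gns n s) := by
  simpa only [orderOf_y hs] using Monoid.order_dvd_exponent (y n s)

theorem exponent_of_odd (hs : s ^ 2 ≡ 1 [ZMOD n]) (hn : Odd n) :
    Monoid.exponent (Gns n s) = 2 * n := by
  refine Nat.dvd_antisymm (card_eq hs ▸ Group.exponent_dvd_nat_card) ?_
  exact hn.coprime_two_left.mul_dvd_of_dvd_of_dvd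
    (orderOf_x (n := n) (s := s) ▸ Monoid.order_dvd_exponent _) (dvd_exponent hs)

theorem odd_of_even (hs : s ^ 2 ≡ 1 [ZMOD n]) (hn : Even n) : Odd s := by
  have h : (2 : ℤ) ∣ 1 - s ^ 2 := (Int.natCast_dvd_natCast.2 hn.two_dvd).trans hs.dvd
  have hsq : Odd (s ^ 2) := by
    rw [Int.odd_iff]
    omega
  exact (Int.odd_pow.1 hsq).resolve_right two_ne_zero

theorem exponent_of_even (hs : s ^ 2 ≡ 1 [ZMOD n]) (hn : Even n) :
    Monoid.exponent (Gns n s) = n := by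
  refine Nat.dvd_antisymm (Monoid.exponent_dvd_of_forall_pow_eq_one fun g => ?_) (dvd_exponent hs)
  obtain ⟨⟨_ | _, a⟩, rfl⟩ := frame_eval_surjective hs g
  · rw [InvolutionFrame.eval_false, ← InvolutionFrame.y_nsmul, nsmul_eq_mul, ZMod.natCast_self,
      zero_mul, InvolutionFrame.y_zero]
  · obtain ⟨k, hk⟩ := hn.two_dvd
    obtain ⟨j, rfl⟩ := odd_of_even hs hn
    have hzero : (2 * k : ZMod n) = 0 := by
      exact_mod_cast (ZMod.natCast_eq_zero_iff (2 * k) n).2 (dvd_of_eq hk)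
    have hsmul : k • ((frame hs).σ a + a) = 0 := by
      rw [frame_σ, nsmul_eq_mul]
      push_cast
      linear_combination (j + 1 : ZMod n) * a * hzero
    calc (frame hs).eval (true, a) ^ n = ((frame hs).eval (true, a) ^ 2) ^ k := by
          rw [← pow_mul, ← hk]
      _ = 1 := by
          rw [InvolutionFrame.eval_true_sq, ← InvolutionFrame.y_nsmul, hsmul,
            InvolutionFrame.y_zero]

theorem isProductOneFree (hn : n ≠ 0) (hs : s ^ 2 ≡ 1 [ZMOD n]) :
    IsProductOneFree (x n s ::ₘ Multiset.replicate (n - 1) (y n s)) := by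
  refine (isProductOneFree_replicate (by rw [orderOf_y hs]; omega)).cons (sign n s)
    (fun w hw => ?_) sign_x_ne_one
  rw [Multiset.eq_of_mem_replicate hw, sign_y]

theorem constants_eq (hn : n ≠ 0) (hs : s ^ 2 ≡ 1 [ZMOD n])
    (hgao : ∀ S : Multiset (Gns n s), 3 * n ≤ Multiset.card S → HasProductOneSub (2 * n) S)
    (hegz : ∀ S : Multiset (Gns n s), n + Monoid.exponent (Gns n s) ≤ Multiset.card S →
      HasProductOneSub (Monoid.exponent (Gns n s)) S) :
    gaoConstant (Gns n s) = 3 * n ∧ egzConstant (Gns n s) = n + Monoid.exponent (Gns n s) ∧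
      etaConstant (Gns n s) = n + 1 ∧ smallDavenport (Gns n s) = n := by
  have hcard := card_eq hs
  have : Finite (Gns n s) := Nat.finite_of_card_ne_zero (by omega)
  have hW : Multiset.card (x n s ::ₘ Multiset.replicate (n - 1) (y n s)) = n := by
    rw [Multiset.card_cons, Multiset.card_replicate]
    omega
  have h := (isProductOneFree hn hs).constants_eq
  rw [hW, hcard, show n + 2 * n = 3 * n by ring] at h
  exact h hgao hegz

theorem hasProductOneSub_of_even (hn0 : n ≠ 0) (hn : Even n) (hs : s ^ 2 ≡ 1 [ZMOD n])
    (hs1 : ¬ s ≡ 1 [ZMOD n]) {S : Multiset (Gns n s)} (hS : 2 * n ≤ Multiset.card S) :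
    HasProductOneSub n S := by
  have : NeZero n := ⟨hn0⟩
  let parity : ZMod n →+* ZMod 2 := ZMod.castHom hn.two_dvd (ZMod 2)
  have hparity (a : ZMod n) : parity ((frame hs).σ a) = parity a := by
    rw [frame_σ, map_mul, map_intCast, ZMod.intCast_eq_one_iff_odd.2 (odd_of_even hs hn), one_mul]
  have hσ : (frame hs).σ 1 ≠ 1 := by
    rw [frame_σ, mul_one]
    exact_mod_cast mt (ZMod.intCast_eq_intCast_iff s 1 n).1 hs1
  refine InvolutionFrame.hasProductOneSub (frame_eval_surjective hs) (fun S hS => ?_) hS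
  obtain ⟨T, hT, hTcard, hT0⟩ := (frame hs).exists_hasProduct_card (par := parity.toAddMonoidHom)
    hparity (ZMod.castHom_surjective hn.two_dvd) ⟨1, hσ⟩ (by rwa [Nat.card_zmod])
  exact ⟨T, hT, by rwa [Nat.card_zmod] at hTcard, hT0⟩

theorem coprime_gcd_add_one_sub_one (hn : Odd n) :
    Nat.Coprime (n.gcd (s + 1).natAbs) (n.gcd (s - 1).natAbs) := by
  refine Nat.eq_one_of_dvd_coprimes hn.coprime_two_left ?_
    ((Nat.gcd_dvd_left _ _).trans (Nat.gcd_dvd_left _ _))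
  have h₁ := Int.natCast_dvd.2
    ((Nat.gcd_dvd_left _ (n.gcd (s - 1).natAbs)).trans (Nat.gcd_dvd_right n (s + 1).natAbs))
  have h₂ := Int.natCast_dvd.2
    ((Nat.gcd_dvd_right (n.gcd (s + 1).natAbs) _).trans (Nat.gcd_dvd_right n (s - 1).natAbs))
  have h := dvd_sub h₁ h₂
  rw [show s + 1 - (s - 1) = 2 by ring] at h
  exact_mod_cast h

theorem exists_isFactorization (hn : Odd n) (hs : s ^ 2 ≡ 1 [ZMOD n])
    (hs1 : ¬ s ≡ 1 [ZMOD n]) (hs2 : ¬ s ≡ -1 [ZMOD n]) : ∃ n₁ n₂, IsFactorization n s n₁ n₂ := by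
  have hcop := coprime_gcd_add_one_sub_one (s := s) hn
  have hdvd : n ∣ n.gcd (s + 1).natAbs * n.gcd (s - 1).natAbs := by
    rw [Nat.dvd_gcd_mul_gcd_iff_dvd_mul, ← Int.natAbs_mul, ← Int.natCast_dvd,
      show (s + 1) * (s - 1) = s ^ 2 - 1 by ring]
    exact hs.symm.dvd
  have hmod₁ : s ≡ -1 [ZMOD (n.gcd (s + 1).natAbs)] := by
    refine (Int.modEq_iff_dvd.2 ?_).symm
    rw [sub_neg_eq_add]
    exact Int.natCast_dvd.2 (Nat.gcd_dvd_right _ _)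
  have hmod₂ : s ≡ 1 [ZMOD (n.gcd (s - 1).natAbs)] :=
    (Int.modEq_iff_dvd.2 (Int.natCast_dvd.2 (Nat.gcd_dvd_right _ _))).symm
  have hmul : n = n.gcd (s + 1).natAbs * n.gcd (s - 1).natAbs :=
    Nat.dvd_antisymm hdvd
      (hcop.mul_dvd_of_dvd_of_dvd (Nat.gcd_dvd_left _ _) (Nat.gcd_dvd_left _ _))
  generalize n.gcd (s + 1).natAbs = n₁ at *
  generalize n.gcd (s - 1).natAbs = n₂ at *
  obtain ⟨hn₁, hn₂⟩ := Nat.odd_mul.1 (hmul ▸ hn)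
  have h₁ : n₁ ≠ 1 := by
    rintro rfl
    exact hs1 (by rwa [hmul, one_mul])
  have h₂ : n₂ ≠ 1 := by
    rintro rfl
    exact hs2 (by rwa [hmul, mul_one])
  exact ⟨n₁, n₂, hmul, hcop, by grind, by grind, hmod₁, hmod₂⟩

theorem comap_frame_σ {n₁ n₂ : ℕ} (hcop : n₁.Coprime n₂) (hs : s ^ 2 ≡ 1 [ZMOD ↑(n₁ * n₂)])
    (hs₁ : s ≡ -1 [ZMOD n₁]) (hs₂ : s ≡ 1 [ZMOD n₂]) (a : ZMod n₁ × ZMod n₂) :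
    ((frame hs).comap (ZMod.chineseRemainder hcop).symm.toAddEquiv).σ a = (-a.1, a.2) := by
  have h₁ : (s : ZMod n₁) = -1 := by exact_mod_cast (ZMod.intCast_eq_intCast_iff _ _ _).2 hs₁
  have h₂ : (s : ZMod n₂) = 1 := by exact_mod_cast (ZMod.intCast_eq_intCast_iff _ _ _).2 hs₂
  change ZMod.chineseRemainder hcop (s * (ZMod.chineseRemainder hcop).symm a) = _
  rw [map_mul, RingEquiv.apply_symm_apply, map_intCast]
  ext
  · simp [h₁]
  · simp [h₂]

theorem hasProductOneSub_of_isFactorization {n₁ n₂ : ℕ} (hn : Odd n) (hs : s ^ 2 ≡ 1 [ZMOD n])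
    (hfac : IsFactorization n s n₁ n₂) (hn₁ : 3 < n₁) {S : Multiset (Gns n s)}
    (hS : 3 * n ≤ Multiset.card S) : HasProductOneSub (2 * n) S := by
  obtain ⟨rfl, hcop, -, hn₂, hs₁, hs₂⟩ := hfac
  obtain ⟨hodd₁, hodd₂⟩ := Nat.odd_mul.1 hn
  have : NeZero n₁ := ⟨by omega⟩
  have : NeZero n₂ := ⟨by omega⟩
  let e := (ZMod.chineseRemainder hcop).toAddEquiv
  have : IsAddCyclic (ZMod n₁ × ZMod n₂) := isAddCyclic_of_surjective e e.surjective
  have hn₁' : 5 ≤ n₁ := by grind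
  refine InvolutionFrame.hasProductOneSub (F := (frame hs).comap e.symm)
    (InvolutionFrame.comap_eval_surjective e.symm (frame_eval_surjective hs)) (fun S hS => ?_) hS
  have h := InvolutionFrame.exists_hasProduct_two_mul (S := S)
    (comap_frame_σ hcop hs hs₁ hs₂)
  simp only [Nat.card_zmod] at h
  exact h hodd₁ hn₁' hodd₂ hn₂ hS

end Gns

end ZeroSum

open ZeroSum in
theorem theorem1p4_general (n : ℕ) (s : ℤ) (hn : n ≠ 0) (hs : s ^ 2 ≡ 1 [ZMOD (n : ℤ)])
    (hs1 : ¬ s ≡ 1 [ZMOD (n : ℤ)]) (hs2 : Odd n → ¬ s ≡ -1 [ZMOD (n : ℤ)])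
    (hodd : Odd n → ∀ n₁ n₂ : ℕ, IsFactorization n s n₁ n₂ → 3 < n₁) :
    gaoConstant (Gns n s) = 3 * n ∧
    egzConstant (Gns n s) = (if Even n then 2 * n else 3 * n) ∧
    egzConstant (Gns n s) = etaConstant (Gns n s) + Monoid.exponent (Gns n s) - 1 ∧
    gaoConstant (Gns n s) = smallDavenport (Gns n s) + Nat.card (Gns n s) := by
  have hcard := Gns.card_eq hs
  rcases Nat.even_or_odd n with heven | hn_odd
  · have hexp := Gns.exponent_of_even hs heven
    have hsub {S : Multiset (Gns n s)} : 2 * n ≤ Multiset.card S → HasProductOneSub n S :=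
      Gns.hasProductOneSub_of_even hn heven hs hs1
    obtain ⟨hE, hegz, heta, hd⟩ := Gns.constants_eq hn hs
      (fun S hS => hasProductOneSub_two_mul (fun _ => hsub) (by omega))
      (fun S hS => by rw [hexp] at hS ⊢; exact hsub (by omega))
    rw [if_pos heven]
    omega
  · have hexp := Gns.exponent_of_odd hs hn_odd
    obtain ⟨n₁, n₂, hfac⟩ := Gns.exists_isFactorization hn_odd hs hs1 (hs2 hn_odd)
    have hsub {S : Multiset (Gns n s)} : 3 * n ≤ Multiset.card S → HasProductOneSub (2 * n) S :=
      Gns.hasProductOneSub_of_isFactorization hn_odd hs hfac (hodd hn_odd n₁ n₂ hfac)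
    obtain ⟨hE, hegz, heta, hd⟩ := Gns.constants_eq hn hs (fun S hS => hsub hS)
      (fun S hS => by rw [hexp] at hS ⊢; exact hsub (by omega))
    rw [if_neg (Nat.not_even_iff_odd.2 hn_odd)]
    omega

theorem theorem1p4 (n : ℕ) (s : ℤ) (hn : 8 ≤ n)
    (hs : s ^ 2 ≡ 1 [ZMOD (n : ℤ)])
    (hs1 : ¬ s ≡ 1 [ZMOD (n : ℤ)])
    (hs2 : ¬ s ≡ -1 [ZMOD (n : ℤ)])
    (hodd : Odd n → ∀ n₁ n₂ : ℕ, ZeroSum.IsFactorization n s n₁ n₂ → 3 < n₁) :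
    ZeroSum.gaoConstant (ZeroSum.Gns n s) = 3 * n ∧
    ZeroSum.egzConstant (ZeroSum.Gns n s) = (if Even n then 2 * n else 3 * n) ∧
    ZeroSum.egzConstant (ZeroSum.Gns n s) =
      ZeroSum.etaConstant (ZeroSum.Gns n s) + Monoid.exponent (ZeroSum.Gns n s) - 1 ∧
    ZeroSum.gaoConstant (ZeroSum.Gns n s) =
      ZeroSum.smallDavenport (ZeroSum.Gns n s) + Nat.card (ZeroSum.Gns n s) :=
  theorem1p4_general n s (by omega) hs hs1 (fun _ => hs2) hodd
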